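/- Let $a\in L^1(0,2\pi)$ be a real-valued magnetic potential with flux $\alpha:=\frac1{2\pi}\int_0^{2\pi}a(x)\,dx$. Let $V$ be a measurable function on $(0,2\pi)$ whose values are $M\times M$ Hermitian matrices with $V(x)\ge0$ for almost every $x$, and suppose that $\operatorname{Tr}V^{3/2}\in L^1(0,2\pi)$. Let $$H=\Bigl(i\frac{d}{dx}-a(x)\Bigr)^2-V(x)$$ be the operator in $L^2(\mathbb S^1;\mathbb C^M)$, $\mathbb S^1=\mathbb R/2\pi\mathbb Z$, associated with the quadratic form $\int_0^{2\pi}|iu'-au|^2\,dx-\int_0^{2\pi}\langle u,Vu\rangle\,dx$ on the absolutely continuous $2\pi$-periodic functions $u$ with $iu'-au\in L^2$. Then the spectrum of $H$ is discrete (it consists of isolated eigenvalues of finite multiplicity). If moreover $\alpha\notin\mathbb Z$, then the negative eigenvalues $-\lambda_n$ of $H$, repeated according to multiplicity, satisfy $$\sum_n\lambda_n\le\frac{2}{3\sqrt3}\,K(\alpha)\int_0^{2\pi}\operatorname{Tr}\bigl[V(x)^{3/2}\bigr]\,dx,$$ where $$K(\alpha)=\begin{cases}|\sin(2\pi\alpha)|^{-1},&\alpha\bmod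 1\in(0,\tfrac14)\cup(\tfrac34,1),\\[2pt] 1,&\alpha\bmod 1\in[\tfrac14,\tfrac34].\end{cases}$$ -/

import Mathlib

open MeasureTheory Set
open scoped ComplexOrder

noncomputable section

namespace MagneticLT

/-! ### Spectral notions for (unbounded) operators -/

section Unbounded

variable {E : Type*} [NormedAddCommGroup E] [NormedSpace ℂ E]

/-- The resolvent set of an unbounded operator `T`: those `z` for which `T - z` is a bijection
from the domain of `T` onto the whole space with a bounded inverse `R`. -/
def resolventSet (T : E →ₗ.[ℂ] E) : Set ℂ :=
  {z | ∃ R : E →L[ℂ] E, ∀ f u : E, R f = u ↔ ∃ hu : u ∈ T.domain, T ⟨u, hu⟩ - z • u = f}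

/-- The spectrum of an unbounded operator. -/
def spectrum (T : E →ₗ.[ℂ] E) : Set ℂ := (resolventSet T)ᶜ

/-- The eigenspace `{u ∈ D(T) : T u = z u}`. -/
def eigenspace (T : E →ₗ.[ℂ] E) (z : ℂ) : Submodule ℂ E where
  carrier := {u | ∃ hu : u ∈ T.domain, T ⟨u, hu⟩ = z • u}
  zero_mem' := ⟨T.domain.zero_mem, by
    have : T ⟨0, T.domain.zero_mem⟩ = 0 := T.map_zero
    simp [this]⟩
  add_mem' := by
    rintro u v ⟨hu, hu'⟩ ⟨hv, hv'⟩
    refine ⟨T.domain.add_mem hu hv, ?_⟩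
    have := T.map_add ⟨u, hu⟩ ⟨v, hv⟩
    rw [hu', hv', ← smul_add] at this
    exact this
  smul_mem' := by
    rintro c u ⟨hu, hu'⟩
    refine ⟨T.domain.smul_mem c hu, ?_⟩
    have := T.map_smul c ⟨u, hu⟩
    rw [hu', smul_comm] at this
    exact this

/-- The spectrum is discrete: it consists of isolated points, each of which is an eigenvalue of
finite multiplicity. -/
def HasDiscreteSpectrum (T : E →ₗ.[ℂ] E) : Prop :=
  DiscreteTopology (spectrum T) ∧
    ∀ z ∈ spectrum T, eigenspace T z ≠ ⊥ ∧ FiniteDimensional ℂ (eigenspace T z)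

/-- The set of `l > 0` such that `-l` is a (negative) eigenvalue of `T`. -/
def negEigenvalues (T : E →ₗ.[ℂ] E) : Set ℝ :=
  {l | 0 < l ∧ eigenspace T (-(l : ℂ)) ≠ ⊥}

/-- The sum `∑ λₙ` over all negative eigenvalues `-λₙ` of `T`, each repeated according to its
multiplicity (for an operator with discrete spectrum all multiplicities are finite). -/
def negEigenvalueSum (T : E →ₗ.[ℂ] E) : ENNReal :=
  ∑' l : negEigenvalues T,
    (Module.finrank ℂ (eigenspace T (-((l : ℝ) : ℂ))) : ENNReal) * ENNReal.ofReal l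

end Unbounded

/-! ### The magnetic Schrödinger operator on the circle `[0, 2π]` with periodic conditions -/

/-- Lebesgue measure on `(0, 2π]`. -/
abbrev circleMeasure : Measure ℝ := volume.restrict (Ioc 0 (2 * Real.pi))

/-- The Hilbert space `L²(S¹; ℂ^M)`. -/
abbrev L2Circle (M : ℕ) : Type := Lp (EuclideanSpace ℂ (Fin M)) 2 circleMeasure

variable {M : ℕ}

theorem ae_differentiableAt {U : ℝ → EuclideanSpace ℂ (Fin M)}
    (hU : AbsolutelyContinuousOnInterval U 0 (2 * Real.pi)) :
    ∀ᵐ x ∂circleMeasure, DifferentiableAt ℝ U x := by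
  rw [ae_restrict_iff' measurableSet_Ioc]
  filter_upwards [hU.boundedVariationOn.ae_differentiableAt_of_mem_uIcc] with x hx hx'
  apply hx
  rw [uIcc_of_le (by positivity)]
  exact Ioc_subset_Icc_self hx'

/-- The graph of the operator `u ↦ i u' - a u`, whose domain consists of the `u ∈ L²` having an
absolutely continuous periodic representative `U` with `i U' - a U ∈ L²`. -/
def magneticDerivGraph (M : ℕ) (a : ℝ → ℝ) : Submodule ℂ (L2Circle M × L2Circle M) where
  carrier := {p | ∃ U : ℝ → EuclideanSpace ℂ (Fin M),
    AbsolutelyContinuousOnInterval U 0 (2 * Real.pi) ∧ U 0 = U (2 * Real.pi) ∧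
    p.1 =ᵐ[circleMeasure] U ∧
    p.2 =ᵐ[circleMeasure] fun x => Complex.I • deriv U x - (a x : ℂ) • U x}
  zero_mem' := by
    refine ⟨fun _ => 0, ?_, rfl, Lp.coeFn_zero _ _ _, ?_⟩
    · exact (LipschitzWith.const (0 : EuclideanSpace ℂ (Fin M))).lipschitzOnWith
        |>.absolutelyContinuousOnInterval
    · filter_upwards [Lp.coeFn_zero (EuclideanSpace ℂ (Fin M)) 2 circleMeasure] with x hx
      simpa using hx
  add_mem' := by
    rintro ⟨u, w⟩ ⟨v, z⟩ ⟨U, hU, hU0, hu, hw⟩ ⟨W, hW, hW0, hv, hz⟩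
    refine ⟨U + W, hU.add hW, by simp [hU0, hW0], ?_, ?_⟩
    · filter_upwards [Lp.coeFn_add u v, hu, hv] with x h1 h2 h3
      simp only [Prod.mk_add_mk] at *
      rw [h1]; simp [h2, h3]
    · filter_upwards [Lp.coeFn_add w z, hw, hz, ae_differentiableAt hU,
        ae_differentiableAt hW] with x h1 h2 h3 h4 h5
      simp only [Prod.mk_add_mk] at *
      rw [h1, deriv_add h4 h5]
      simp only [Pi.add_apply, h2, h3, smul_add]
      abel
  smul_mem' := by
    rintro c ⟨u, w⟩ ⟨U, hU, hU0, hu, hw⟩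
    refine ⟨c • U, hU.const_smul c, by simp [hU0], ?_, ?_⟩
    · filter_upwards [Lp.coeFn_smul c u, hu] with x h1 h2
      simp only [Prod.smul_mk] at *
      rw [h1]; simp [h2]
    · filter_upwards [Lp.coeFn_smul c w, hw, ae_differentiableAt hU] with x h1 h2 h4
      simp only [Prod.smul_mk] at *
      rw [h1, deriv_const_smul c h4]
      simp only [Pi.smul_apply, h2, smul_sub]
      rw [smul_comm c, smul_comm c]

theorem magneticDerivGraph_single (a : ℝ → ℝ) (p : L2Circle M × L2Circle M)
    (hp : p ∈ magneticDerivGraph M a) (h0 : p.1 = 0) : p.2 = 0 := by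
  obtain ⟨U, hU, -, hu, hw⟩ := hp
  have hpi : (0 : ℝ) < 2 * Real.pi := by positivity
  have hc : ContinuousOn U (Ioo 0 (2 * Real.pi)) := by
    refine hU.continuousOn.mono ?_
    rw [uIcc_of_le hpi.le]
    exact Ioo_subset_Icc_self
  have h1 : U =ᵐ[volume.restrict (Ioo 0 (2 * Real.pi))] fun _ => 0 := by
    have : U =ᵐ[circleMeasure] fun _ => 0 := by
      filter_upwards [hu, Lp.coeFn_zero (EuclideanSpace ℂ (Fin M)) 2 circleMeasure] with x h1 h2
      rw [← h1, h0, h2]; rfl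
    exact ae_mono (Measure.restrict_mono Ioo_subset_Ioc_self le_rfl) this
  have h2 : EqOn U (fun _ => 0) (Ioo 0 (2 * Real.pi)) :=
    Measure.eqOn_open_of_ae_eq h1 isOpen_Ioo hc continuousOn_const
  apply Lp.ext
  have h3 : ∀ᵐ x ∂circleMeasure, x ∈ Ioo 0 (2 * Real.pi) := by
    rw [circleMeasure, ← restrict_Ioo_eq_restrict_Ioc]
    exact ae_restrict_mem measurableSet_Ioo
  filter_upwards [hw, h3, Lp.coeFn_zero (EuclideanSpace ℂ (Fin M)) 2 circleMeasure]
    with x h4 h5 h6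
  have h7 : deriv U x = 0 := by
    rw [Filter.EventuallyEq.deriv_eq (f := fun _ => 0)]
    · simp
    · exact Filter.eventuallyEq_of_mem (isOpen_Ioo.mem_nhds h5) h2
  rw [h4, h6, h7, h2 h5]
  simp

/-- The operator `i d/dx - a` in `L²(S¹; ℂ^M)`. -/
def magneticDeriv (M : ℕ) (a : ℝ → ℝ) : L2Circle M →ₗ.[ℂ] L2Circle M :=
  (magneticDerivGraph M a).toLinearPMap

theorem magneticDeriv_graph (M : ℕ) (a : ℝ → ℝ) :
    (magneticDeriv M a).graph = magneticDerivGraph M a :=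
  Submodule.toLinearPMap_graph_eq _ (magneticDerivGraph_single a)

/-- The integrand `⟨v(x), V(x) u(x)⟩` of the quadratic form of the potential. -/
def potentialPairing (V : ℝ → Matrix (Fin M) (Fin M) ℂ) (v u : L2Circle M) (x : ℝ) : ℂ :=
  inner ℂ (v x) (Matrix.toEuclideanLin (V x) (u x))

theorem potentialPairing_add (V : ℝ → Matrix (Fin M) (Fin M) ℂ) (v u u' : L2Circle M) :
    potentialPairing V v (u + u') =ᵐ[circleMeasure]
      potentialPairing V v u + potentialPairing V v u' := by
  filter_upwards [Lp.coeFn_add u u'] with x hx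
  simp only [potentialPairing, hx, Pi.add_apply, map_add, inner_add_right]

theorem potentialPairing_smul (V : ℝ → Matrix (Fin M) (Fin M) ℂ) (c : ℂ) (v u : L2Circle M) :
    potentialPairing V v (c • u) =ᵐ[circleMeasure] c • potentialPairing V v u := by
  filter_upwards [Lp.coeFn_smul c u] with x hx
  simp only [potentialPairing, hx, Pi.smul_apply, map_smul, inner_smul_right, smul_eq_mul]

/-- The graph of `(i d/dx - a)² - V`, the operator associated with the quadratic form
`‖(i d/dx - a) u‖² - ∫ ⟨u, V u⟩`: the pair `(u, f)` belongs to it iff `u` lies in the form domain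
(the domain of `i d/dx - a`) and
`⟨(i d/dx - a) v, (i d/dx - a) u⟩ - ∫ ⟨v, V u⟩ = ⟨v, f⟩` for all `v` in the form domain. -/
def schrodingerGraph (a : ℝ → ℝ) (V : ℝ → Matrix (Fin M) (Fin M) ℂ) :
    Submodule ℂ (L2Circle M × L2Circle M) where
  carrier := {p | ∃ hu : p.1 ∈ (magneticDeriv M a).domain, ∀ v : (magneticDeriv M a).domain,
    Integrable (potentialPairing V v p.1) circleMeasure ∧
    inner ℂ (magneticDeriv M a v) (magneticDeriv M a ⟨p.1, hu⟩)
      - ∫ x, potentialPairing V v p.1 x ∂circleMeasure = inner ℂ (v : L2Circle M) p.2}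
  zero_mem' := by
    refine ⟨Submodule.zero_mem _, fun v => ?_⟩
    have h : potentialPairing V v (0 : L2Circle M) =ᵐ[circleMeasure] 0 := by
      simpa using potentialPairing_smul V 0 v 0
    have h' : magneticDeriv M a ⟨(0 : L2Circle M), Submodule.zero_mem _⟩ = 0 :=
      (magneticDeriv M a).map_zero
    refine ⟨(integrable_congr h).2 (integrable_zero _ _ _), ?_⟩
    simp only [Prod.fst_zero, Prod.snd_zero, h', inner_zero_right]
    rw [integral_congr_ae h]
    simp
  add_mem' := by
    rintro ⟨u, f⟩ ⟨u', f'⟩ ⟨hu, h⟩ ⟨hu', h'⟩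
    refine ⟨Submodule.add_mem _ hu hu', fun v => ?_⟩
    obtain ⟨h1, h2⟩ := h v
    obtain ⟨h1', h2'⟩ := h' v
    have hadd := potentialPairing_add V (v : L2Circle M) u u'
    have hD : magneticDeriv M a ⟨u + u', Submodule.add_mem _ hu hu'⟩
        = magneticDeriv M a ⟨u, hu⟩ + magneticDeriv M a ⟨u', hu'⟩ :=
      (magneticDeriv M a).map_add ⟨u, hu⟩ ⟨u', hu'⟩
    refine ⟨(integrable_congr hadd).2 (h1.add h1'), ?_⟩
    simp only [Prod.mk_add_mk] at *
    rw [integral_congr_ae hadd, hD, inner_add_right, inner_add_right, ← h2, ← h2']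
    simp only [Pi.add_apply]
    rw [integral_add h1 h1']
    ring
  smul_mem' := by
    rintro c ⟨u, f⟩ ⟨hu, h⟩
    refine ⟨Submodule.smul_mem _ c hu, fun v => ?_⟩
    obtain ⟨h1, h2⟩ := h v
    have hsmul := potentialPairing_smul V c (v : L2Circle M) u
    have hD : magneticDeriv M a ⟨c • u, Submodule.smul_mem _ c hu⟩
        = c • magneticDeriv M a ⟨u, hu⟩ := (magneticDeriv M a).map_smul c ⟨u, hu⟩
    refine ⟨(integrable_congr hsmul).2 (h1.smul c), ?_⟩
    simp only [Prod.smul_mk] at *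
    rw [integral_congr_ae hsmul, hD, inner_smul_right, inner_smul_right, ← h2]
    simp only [Pi.smul_apply]
    rw [integral_smul, smul_eq_mul]
    ring

/-- The phase `exp(-i ∫₀ˣ a)`. -/
def phase (a : ℝ → ℝ) (x : ℝ) : ℂ := Complex.exp (-((∫ t in (0 : ℝ)..x, a t : ℝ) : ℂ) * Complex.I)

theorem norm_phase (a : ℝ → ℝ) (x : ℝ) : ‖phase a x‖ = 1 := by
  rw [phase, ← Complex.ofReal_neg, Complex.norm_exp_ofReal_mul_I]

theorem phase_lipschitz :
    LipschitzWith 1 (fun t : ℝ => Complex.exp (-(t : ℂ) * Complex.I)) := by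
  have hd : ∀ t : ℝ, HasDerivAt (fun t : ℝ => Complex.exp (-(t : ℂ) * Complex.I))
      (Complex.exp (-(t : ℂ) * Complex.I) * (-1 * Complex.I)) t := fun t =>
    ((Complex.ofRealCLM.hasDerivAt (x := t)).neg.mul_const Complex.I).cexp
  refine lipschitzWith_of_nnnorm_deriv_le (fun t => (hd t).differentiableAt) fun t => ?_
  rw [(hd t).deriv, ← NNReal.coe_le_coe, coe_nnnorm, norm_mul, ← Complex.ofReal_neg,
    Complex.norm_exp_ofReal_mul_I]
  simp

theorem phase_ac {a : ℝ → ℝ} (ha : IntegrableOn a (Ioc 0 (2 * Real.pi))) :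
    AbsolutelyContinuousOnInterval (phase a) 0 (2 * Real.pi) := by
  have hi : IntervalIntegrable a volume 0 (2 * Real.pi) :=
    (intervalIntegrable_iff_integrableOn_Ioc_of_le (by positivity)).2 ha
  have h := hi.absolutelyContinuousOnInterval_intervalIntegral (c := 0) left_mem_uIcc
  refine squeeze_zero (fun _ => Finset.sum_nonneg fun _ _ => dist_nonneg) (fun E => ?_) h
  refine Finset.sum_le_sum fun i _ => ?_
  simpa [phase] using phase_lipschitz.dist_le_mul (∫ t in (0 : ℝ)..(E.2 i).1, a t)
    (∫ t in (0 : ℝ)..(E.2 i).2, a t)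

theorem phase_hasDerivAt {a : ℝ → ℝ} (ha : IntegrableOn a (Ioc 0 (2 * Real.pi))) :
    ∀ᵐ x ∂circleMeasure, HasDerivAt (phase a) (phase a x * (-(a x : ℂ) * Complex.I)) x := by
  have hpi : (0 : ℝ) ≤ 2 * Real.pi := by positivity
  have hi : IntervalIntegrable a volume 0 (2 * Real.pi) :=
    (intervalIntegrable_iff_integrableOn_Ioc_of_le hpi).2 ha
  rw [ae_restrict_iff' measurableSet_Ioc]
  filter_upwards [hi.ae_hasDerivAt_integral] with x hx hx'
  have h1 := hx (by rw [uIcc_of_le hpi]; exact Ioc_subset_Icc_self hx') 0 left_mem_uIcc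
  exact (h1.ofReal_comp.neg.mul_const Complex.I).cexp

/-- The form domain is dense: an `f` orthogonal to it vanishes. -/
theorem eq_zero_of_orthogonal {a : ℝ → ℝ} (ha : IntegrableOn a (Ioc 0 (2 * Real.pi)))
    (f : L2Circle M)
    (h : ∀ v : (magneticDeriv M a).domain, inner ℂ (v : L2Circle M) f = 0) : f = 0 := by
  have hpi : (0 : ℝ) ≤ 2 * Real.pi := by positivity
  have hmeas : ∀ F : ℝ → EuclideanSpace ℂ (Fin M),
      AbsolutelyContinuousOnInterval F 0 (2 * Real.pi) →
      AEStronglyMeasurable F circleMeasure := fun F hF => by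
    refine ContinuousOn.aestronglyMeasurable ?_ measurableSet_Ioc
    refine hF.continuousOn.mono ?_
    rw [uIcc_of_le hpi]
    exact Ioc_subset_Icc_self
  have hconst : ∀ e : EuclideanSpace ℂ (Fin M),
      AbsolutelyContinuousOnInterval (fun _ => e) 0 (2 * Real.pi) := fun e =>
    (LipschitzWith.const e).lipschitzOnWith.absolutelyContinuousOnInterval
  have hfi : Integrable f circleMeasure := (Lp.memLp f).integrable (by norm_num)
  have hphm : AEStronglyMeasurable (phase a) circleMeasure := by
    refine ContinuousOn.aestronglyMeasurable ?_ measurableSet_Ioc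
    refine (phase_ac ha).continuousOn.mono ?_
    rw [uIcc_of_le hpi]
    exact Ioc_subset_Icc_self
  have key : ∀ j : Fin M, ∀ᵐ x, x ∈ Ioo 0 (2 * Real.pi) →
      (starRingEnd ℂ) (phase a x) * f x j = 0 := by
    intro j
    have hint : Integrable (fun x => (starRingEnd ℂ) (phase a x) * f x j) circleMeasure := by
      have hfj : Integrable (fun x => f x j) circleMeasure :=
        (EuclideanSpace.proj (𝕜 := ℂ) j).integrable_comp hfi
      refine hfj.bdd_mul (c := 1) (Complex.continuous_conj.comp_aestronglyMeasurable hphm) ?_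
      filter_upwards with x
      simp [norm_phase]
    refine isOpen_Ioo.ae_eq_zero_of_integral_contDiff_smul_eq_zero ?_ ?_
    · have : IntegrableOn (fun x => (starRingEnd ℂ) (phase a x) * f x j)
        (Ioc 0 (2 * Real.pi)) := hint
      exact (this.mono_set Ioo_subset_Ioc_self).locallyIntegrableOn
    · intro g hg hgc hgs
      set e : EuclideanSpace ℂ (Fin M) := EuclideanSpace.single j 1 with he
      set U : ℝ → EuclideanSpace ℂ (Fin M) := g • (phase a • fun _ => e) with hU
      set W : ℝ → EuclideanSpace ℂ (Fin M) :=
        fun x => (Complex.I * ((deriv g x : ℝ) : ℂ) * phase a x) • e with hW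
      have hgac : AbsolutelyContinuousOnInterval g 0 (2 * Real.pi) :=
        (hg.of_le (by exact_mod_cast le_top)).contDiffOn.absolutelyContinuousOnInterval
      have hUac : AbsolutelyContinuousOnInterval U 0 (2 * Real.pi) :=
        hgac.smul ((phase_ac ha).smul (hconst e))
      have hg0 : ∀ x, x ∉ Ioo 0 (2 * Real.pi) → g x = 0 := fun x hx =>
        image_eq_zero_of_notMem_tsupport fun hx' => hx (hgs hx')
      obtain ⟨C, hC⟩ := hUac.exists_bound
      have hUL : MemLp U 2 circleMeasure := by
        refine MemLp.of_bound (hmeas U hUac) C ?_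
        rw [ae_restrict_iff' measurableSet_Ioc]
        filter_upwards with x hx
        exact hC x (by rw [uIcc_of_le hpi]; exact Ioc_subset_Icc_self hx)
      have hdg : Continuous (deriv g) := hg.continuous_deriv (by exact_mod_cast le_top)
      obtain ⟨C', hC'⟩ := hdg.bounded_above_of_compact_support hgc.deriv
      have hWL : MemLp W 2 circleMeasure := by
        refine MemLp.of_bound ?_ C' ?_
        · exact (((Complex.continuous_ofReal.comp hdg).aestronglyMeasurable.const_mul
            Complex.I).mul hphm).smul_const e
        · filter_upwards with x
          simpa [hW, norm_smul, norm_phase, he] using hC' x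
      have hmem : (hUL.toLp U, hWL.toLp W) ∈ magneticDerivGraph M a := by
        refine ⟨U, hUac, ?_, hUL.coeFn_toLp, ?_⟩
        · simp [hU, hg0]
        · filter_upwards [hWL.coeFn_toLp, phase_hasDerivAt ha] with x h1 h2
          have h3 : HasDerivAt g (deriv g x) x :=
            (hg.differentiable (by simp) x).hasDerivAt
          have h4 : HasDerivAt U _ x := h3.smul (h2.smul_const e)
          rw [h1, h4.deriv]
          simp only [hW, hU, Pi.smul_apply', smul_add]
          ext k
          simp only [PiLp.add_apply, PiLp.sub_apply, PiLp.smul_apply, smul_eq_mul,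
            Complex.real_smul]
          linear_combination ((a x : ℂ) * g x * phase a x * e k) * Complex.I_mul_I
      have hdom : hUL.toLp U ∈ (magneticDeriv M a).domain := by
        have : (hUL.toLp U, hWL.toLp W) ∈ (magneticDeriv M a).graph := by
          rw [magneticDeriv_graph]; exact hmem
        exact LinearPMap.mem_domain_of_mem_graph this
      have h0 := h ⟨_, hdom⟩
      rw [MeasureTheory.L2.inner_def] at h0
      have h5 : ∫ x in Ioc 0 (2 * Real.pi), g x • ((starRingEnd ℂ) (phase a x) * f x j) = 0 := by
        rw [← h0]
        refine integral_congr_ae ?_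
        filter_upwards [hUL.coeFn_toLp] with x h1
        rw [h1]
        simp only [hU, Pi.smul_apply', he, inner_smul_left, EuclideanSpace.inner_single_left,
          map_one, one_mul, inner_smul_left_eq_smul]
      rw [← h5, ← integral_indicator measurableSet_Ioc]
      congr 1
      ext x
      by_cases hx : x ∈ Ioc 0 (2 * Real.pi)
      · rw [indicator_of_mem hx]
      · rw [indicator_of_notMem hx, hg0 x fun hx' => hx (Ioo_subset_Ioc_self hx'), zero_smul]
  apply Lp.ext
  have hall : ∀ᵐ x, ∀ j : Fin M, x ∈ Ioo 0 (2 * Real.pi) →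
      (starRingEnd ℂ) (phase a x) * f x j = 0 := ae_all_iff.2 key
  have h3 : ∀ᵐ x ∂circleMeasure, x ∈ Ioo 0 (2 * Real.pi) := by
    rw [circleMeasure, ← restrict_Ioo_eq_restrict_Ioc]
    exact ae_restrict_mem measurableSet_Ioo
  filter_upwards [ae_restrict_of_ae hall, h3,
    Lp.coeFn_zero (EuclideanSpace ℂ (Fin M)) 2 circleMeasure] with x h4 h5 h6
  rw [h6]
  ext j
  have h7 : (starRingEnd ℂ) (phase a x) ≠ 0 := by
    rw [Ne, ← norm_eq_zero]
    simp [norm_phase]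
  simpa [h7] using h4 j h5

theorem schrodingerGraph_single {a : ℝ → ℝ} (ha : IntegrableOn a (Ioc 0 (2 * Real.pi)))
    (V : ℝ → Matrix (Fin M) (Fin M) ℂ) (p : L2Circle M × L2Circle M)
    (hp : p ∈ schrodingerGraph a V) (h0 : p.1 = 0) : p.2 = 0 := by
  obtain ⟨u, f⟩ := p
  simp only at h0
  subst h0
  obtain ⟨hu, h⟩ := hp
  refine eq_zero_of_orthogonal ha f fun v => ?_
  obtain ⟨-, h2⟩ := h v
  have hz : potentialPairing V v (0 : L2Circle M) =ᵐ[circleMeasure] 0 := by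
    simpa using potentialPairing_smul V 0 v 0
  have h' : magneticDeriv M a ⟨(0 : L2Circle M), hu⟩ = 0 := (magneticDeriv M a).map_zero
  rw [← h2, h', integral_congr_ae hz]
  simp

/-- The magnetic Schrödinger operator `(i d/dx - a)² - V` in `L²(S¹; ℂ^M)`. -/
def schrodingerOperator (a : ℝ → ℝ) (V : ℝ → Matrix (Fin M) (Fin M) ℂ) :
    L2Circle M →ₗ.[ℂ] L2Circle M :=
  (schrodingerGraph a V).toLinearPMap

/-- For an integrable magnetic potential, `schrodingerGraph` is indeed the graph of the operator. -/
theorem schrodingerOperator_graph {a : ℝ → ℝ} (ha : IntegrableOn a (Ioc 0 (2 * Real.pi)))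
    (V : ℝ → Matrix (Fin M) (Fin M) ℂ) :
    (schrodingerOperator a V).graph = schrodingerGraph a V :=
  Submodule.toLinearPMap_graph_eq _ (schrodingerGraph_single ha V)

/-! ### The constants -/

/-- The magnetic flux `α = (1/2π) ∫₀^{2π} a`. -/
def flux (a : ℝ → ℝ) : ℝ := 1 / (2 * Real.pi) * ∫ x in (0 : ℝ)..(2 * Real.pi), a x

/-- The constant `K(α)`, for non-integral `α`. -/
def magneticConst (α : ℝ) : ℝ :=
  if Int.fract α ∈ Icc (1 / 4 : ℝ) (3 / 4) then 1 else |Real.sin (2 * Real.pi * α)|⁻¹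

/-- `Tr A^{3/2}` for a positive semidefinite Hermitian matrix `A` (the power being taken in the
functional calculus). -/
def tracePowThreeHalves (A : Matrix (Fin M) (Fin M) ℂ) : ℝ :=
  (Matrix.trace (cfc (fun t : ℝ => t ^ (3 / 2 : ℝ)) A)).re

end MagneticLT

end

/-! Discreteness comes from a compact resolvent. An element of the form domain is determined by its
value `c` at `0` and by `g = i u' - a u`. Multiplying `u` by `phase (-a)` removes `a`: the result is
`c` plus the primitive of a function of modulus `‖g‖`, hence Hölder-1/2, and Arzelà–Ascoli makes the
embedding of the form domain into `L²` compact. A sup-norm bound with a large parameter `k` lets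
half of the kinetic energy absorb the potential, so a shift of the form is coercive and
`hasDiscreteSpectrum_of_form` applies.

For the inequality, the gauge transform is quasi-periodic with twist `exp(2πiα)`. The diagonal Green
function of `-d²/dx² + k²` with this twist is `sinh(2πk) / (2k (cosh(2πk) - cos(2πα)))`, which is at
most `K(α)/(2k)` (`sinh_le_magneticConst_mul`). Hence `2k |⟨b, u(x)⟩|² ≤ K (‖g‖² + k²‖u‖²)` for unit
`b`. Let `uᵢ` be orthonormal in `L²` with magnetic derivatives `gᵢ`, put `cᵢ = ⟨uᵢ(x), b⟩` and `ρ =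
∑ |cᵢ|²`. Applied to `∑ cᵢ uᵢ` with `k = ρ/K`, the bound gives `ρ³/K² ≤ ‖∑ cᵢ gᵢ‖²`
(`density_cube_le`).

At a fixed `x`, let `b` run through an eigenbasis of `V(x)`, combine with Young's inequality `v ρ ≤
ρ³/K² + 2/(3√3) K v^(3/2)`, and sum. The right-hand kinetic term no longer depends on the basis, and
by orthonormality its integral is `∑ ‖gᵢ‖²`. So minus the sum of the form values is at most the
claimed bound (`neg_sum_form_le`); eigenvectors for the negative eigenvalues give the theorem. -/

noncomputable section

namespace MagneticLT

/-! ### Compact resolvents and discrete spectrum -/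

section Abstract

variable {H W : Type*} [NormedAddCommGroup H] [InnerProductSpace ℂ H]
  [NormedAddCommGroup W] [InnerProductSpace ℂ W]

open Module.End

/-- The eigenvalues of a compact symmetric operator can accumulate only at zero. -/
theorem finite_eigenvalues_of_isCompactOperator {R : H →L[ℂ] H} (hR : IsCompactOperator R)
    (hs : (R : H →ₗ[ℂ] H).IsSymmetric) {ε : ℝ} (hε : 0 < ε) :
    {ν : ℂ | ε ≤ ‖ν‖ ∧ HasEigenvalue (R : Module.End ℂ H) ν}.Finite := by
  by_contra hinf
  have hinf : {ν : ℂ | ε ≤ ‖ν‖ ∧ HasEigenvalue (R : Module.End ℂ H) ν}.Infinite := hinf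
  set ν := hinf.natEmbedding with hν
  have hex : ∀ n, ∃ e : H, ‖e‖ = 1 ∧ R e = (ν n : ℂ) • e := by
    intro n
    obtain ⟨v, hv⟩ := (ν n).2.2.exists_hasEigenvector
    have hv0 : ‖v‖ ≠ 0 := norm_ne_zero_iff.2 hv.2
    refine ⟨((‖v‖⁻¹ : ℝ) : ℂ) • v, ?_, ?_⟩
    · rw [norm_smul, Complex.norm_real, norm_inv, norm_norm, inv_mul_cancel₀ hv0]
    · rw [map_smul, smul_comm]
      congr 1
      exact hv.apply_eq_smul
  choose e he1 he2 using hex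
  -- Unit eigenvectors for distinct eigenvalues are orthogonal, so their images stay `ε` apart and
  -- have no convergent subsequence.
  have hsep : ∀ n m, n ≠ m → ε ≤ ‖R (e n) - R (e m)‖ := by
    intro n m hnm
    have horth : inner ℂ (R (e n)) (R (e m)) = 0 := by
      have hne : (ν n : ℂ) ≠ ν m := fun h => hnm (ν.injective (Subtype.ext h))
      have h0 := (hs.orthogonalFamily_eigenspaces) hne
        ⟨e n, mem_eigenspace_iff.2 (he2 n)⟩ ⟨e m, mem_eigenspace_iff.2 (he2 m)⟩
      have h0' : inner ℂ (e n) (e m) = 0 := h0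
      rw [he2, he2, inner_smul_left, inner_smul_right, h0']
      simp
    have h1 : ‖R (e n) - R (e m)‖ ^ 2 = ‖R (e n)‖ ^ 2 + ‖R (e m)‖ ^ 2 := by
      rw [@norm_sub_sq ℂ, horth]; simp
    have h2 : ε ≤ ‖R (e n)‖ := by
      rw [he2, norm_smul, he1, mul_one]; exact (ν n).2.1
    refine le_of_sq_le_sq ?_ (norm_nonneg _)
    rw [h1]
    nlinarith [sq_nonneg ‖R (e m)‖]
  obtain ⟨K, hK, hK'⟩ := hR.image_closedBall_subset_compact 1
  obtain ⟨y, hyK, ψ, hψ, hψy⟩ := hK.tendsto_subseq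
    (fun n => hK' ⟨e n, by simp [he1], rfl⟩)
  have hc := hψy.cauchySeq
  rw [Metric.cauchySeq_iff'] at hc
  obtain ⟨N, hN⟩ := hc ε hε
  have h3 := hN (N + 1) (by omega)
  rw [dist_eq_norm] at h3
  exact absurd h3 (not_lt.2 (hsep _ _ (hψ.injective.ne (by omega))))

/-- The eigenspaces of a compact operator to nonzero eigenvalues are finite-dimensional. -/
theorem finiteDimensional_eigenspace_of_isCompactOperator [CompleteSpace H] {R : H →L[ℂ] H}
    (hR : IsCompactOperator R) {ν : ℂ} (hν : ν ≠ 0) :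
    FiniteDimensional ℂ (Module.End.eigenspace (R : Module.End ℂ H) ν) := by
  have hclosed : IsClosed (Module.End.eigenspace (R : Module.End ℂ H) ν : Set H) := by
    have : (Module.End.eigenspace (R : Module.End ℂ H) ν : Set H) = {x | R x = ν • x} := by
      ext x; simp
    rw [this]
    exact isClosed_eq R.continuous (continuous_const_smul ν)
  set S := Module.End.eigenspace (R : Module.End ℂ H) ν
  have hmap : ∀ v ∈ S, (ν⁻¹ • (R : H →ₗ[ℂ] H)) v ∈ S := by
    intro v hv
    have : (R : H →ₗ[ℂ] H) v = ν • v := mem_eigenspace_iff.1 hv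
    rw [LinearMap.smul_apply, this, smul_smul, inv_mul_cancel₀ hν, one_smul]
    exact hv
  have hc : IsCompactOperator (ν⁻¹ • (R : H →ₗ[ℂ] H)) := by
    simpa using hR.smul ν⁻¹
  have h1 := hc.restrict hmap hclosed
  -- On the eigenspace `ν⁻¹ R` is the identity, so the identity is compact there.
  refine FiniteDimensional.of_isCompactOperator_id (𝕜 := ℂ) ?_
  have heq : (id : S → S) = (ν⁻¹ • (R : H →ₗ[ℂ] H)).restrict hmap := by
    funext v
    refine Subtype.ext ?_
    have : (R : H →ₗ[ℂ] H) v = ν • (v : H) := mem_eigenspace_iff.1 v.2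
    rw [LinearMap.coe_restrict_apply, LinearMap.smul_apply, this, smul_smul, inv_mul_cancel₀ hν,
      one_smul]
    rfl
  rw [heq]
  exact h1

/-- An operator one of whose (shifted) inverses `R` is compact and symmetric has discrete
spectrum. -/
theorem hasDiscreteSpectrum_of_compact_resolvent [CompleteSpace H] {T : H →ₗ.[ℂ] H}
    {R : H →L[ℂ] H} {μ : ℝ}
    (hR : IsCompactOperator R) (hs : (R : H →ₗ[ℂ] H).IsSymmetric)
    (hT : ∀ u f : H, (∃ hu : u ∈ T.domain, T ⟨u, hu⟩ = f) ↔ R (f + (μ : ℂ) • u) = u) :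
    HasDiscreteSpectrum T := by
  -- `hT` says that `R` is the inverse of `T + μ`; this is the resulting equation for `T - z`.
  have hT' : ∀ (z : ℂ) (u f : H), (∃ hu : u ∈ T.domain, T ⟨u, hu⟩ - z • u = f) ↔
      R (f + (z + μ) • u) = u := by
    intro z u f
    rw [add_smul, ← add_assoc, ← hT]
    simp only [sub_eq_iff_eq_add]
  have hmu : -(μ : ℂ) ∈ resolventSet T := by
    refine ⟨R, fun f u => ?_⟩
    rw [hT']; simp
  have heig : ∀ z : ℂ, z + μ ≠ 0 →
      eigenspace T z = Module.End.eigenspace (R : Module.End ℂ H) (z + μ)⁻¹ := by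
    intro z hz
    ext u
    have h1 : u ∈ eigenspace T z ↔ ∃ hu : u ∈ T.domain, T ⟨u, hu⟩ - z • u = 0 := by
      simp only [sub_eq_zero]; rfl
    rw [h1, hT', zero_add, mem_eigenspace_iff, map_smul]
    constructor
    · intro h
      rw [eq_inv_smul_iff₀ hz]; exact h
    · intro h
      rw [eq_inv_smul_iff₀ hz] at h; exact h
  have hspec : ∀ z ∈ spectrum T, z + μ ≠ 0 ∧ HasEigenvalue (R : Module.End ℂ H) (z + μ)⁻¹ := by
    intro z hz
    have hz0 : z + μ ≠ 0 := by
      intro h0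
      rw [add_eq_zero_iff_eq_neg] at h0
      exact hz (h0 ▸ hmu)
    refine ⟨hz0, ?_⟩
    -- Fredholm alternative: it suffices that `(z + μ)⁻¹` lies in the spectrum of `R`. Otherwise `w
    -- = (z + μ)⁻¹ - R` is invertible, and `w⁻¹ (z + μ)⁻¹ R` inverts `T - z`.
    rw [hR.hasEigenvalue_iff_mem_spectrum (inv_ne_zero hz0)]
    intro hres
    apply hz
    obtain ⟨w, hw⟩ := hres
    have hw' : ∀ x, (w : H →L[ℂ] H) x = (z + μ)⁻¹ • x - R x := fun x => by
      rw [hw]; simp [Algebra.algebraMap_eq_smul_one]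
    refine ⟨(↑w⁻¹ : H →L[ℂ] H) ∘L ((z + μ)⁻¹ • R), fun f u => ?_⟩
    rw [hT']
    have h2 : ((↑w⁻¹ : H →L[ℂ] H) ∘L ((z + μ)⁻¹ • R)) f = u ↔ (z + μ)⁻¹ • R f = (w : H →L[ℂ] H) u := by
      constructor
      · intro h
        rw [← h]
        have : (w : H →L[ℂ] H) * (↑w⁻¹ : H →L[ℂ] H) = 1 := w.mul_inv
        exact (DFunLike.congr_fun this ((z + μ)⁻¹ • R f)).symm
      · intro h
        have : (↑w⁻¹ : H →L[ℂ] H) * (w : H →L[ℂ] H) = 1 := w.inv_mul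
        rw [ContinuousLinearMap.comp_apply, smul_apply, h]
        exact DFunLike.congr_fun this u
    rw [h2, hw', map_add, map_smul, inv_smul_eq_iff₀ hz0, smul_sub, smul_inv_smul₀ hz0,
      eq_sub_iff_add_eq]
  refine ⟨?_, fun z hz => ?_⟩
  · have hloc : ∀ z ∈ spectrum T, ∃ U : Set ℂ, IsOpen U ∧ z ∈ U ∧ (U ∩ spectrum T).Finite := by
      intro z hz
      refine ⟨Metric.ball z 1, Metric.isOpen_ball, Metric.mem_ball_self one_pos, ?_⟩
      -- Spectral points `y` within distance `1` of `z` give eigenvalues `(y + μ)⁻¹` of `R` of at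
      -- least this modulus; there are finitely many of them.
      have hpos : (0 : ℝ) < (‖z + μ‖ + 1)⁻¹ := by positivity
      have hfin := finite_eigenvalues_of_isCompactOperator hR hs hpos
      refine (hfin.image (fun ν => ν⁻¹ - (μ : ℂ))).subset ?_
      rintro y ⟨hy1, hy2⟩
      obtain ⟨h0, h1⟩ := hspec y hy2
      refine ⟨(y + μ)⁻¹, ⟨?_, h1⟩, by simp⟩
      rw [norm_inv]
      refine inv_anti₀ (norm_pos_iff.2 h0) ?_
      calc ‖y + μ‖ = ‖(z + μ) + (y - z)‖ := by ring_nf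
        _ ≤ ‖z + μ‖ + ‖y - z‖ := norm_add_le _ _
        _ ≤ _ := by
          have : ‖y - z‖ < 1 := by rw [← dist_eq_norm]; exact hy1
          linarith
    rw [discreteTopology_subtype_iff']
    intro z hz
    obtain ⟨U, hU, hzU, hfin⟩ := hloc z hz
    refine ⟨U \ ((U ∩ spectrum T) \ {z}), hU.sdiff hfin.sdiff.isClosed, ?_⟩
    ext y
    simp only [mem_inter_iff, mem_sdiff, mem_singleton_iff, not_and, not_not]
    constructor
    · rintro ⟨⟨h1, h2⟩, h3⟩
      exact h2 ⟨h1, h3⟩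
    · rintro rfl
      exact ⟨⟨hzU, fun _ => rfl⟩, hz⟩
  · obtain ⟨h0, h1⟩ := hspec z hz
    rw [heig z h0]
    exact ⟨h1, finiteDimensional_eigenspace_of_isCompactOperator hR (inv_ne_zero h0)⟩

/-- The operator associated with a bounded Hermitian form `h` on a Hilbert space `W` which is
compactly mapped into `H` has discrete spectrum, if `h` is coercive after a shift. -/
theorem hasDiscreteSpectrum_of_form [CompleteSpace H] [CompleteSpace W] {T : H →ₗ.[ℂ] H}
    {J : W →L[ℂ] H} (hJ : IsCompactOperator J)
    {h : W →L⋆[ℂ] W →L[ℂ] ℂ} (hherm : ∀ v w, h v w = starRingEnd ℂ (h w v)) {μ c : ℝ} (hc : 0 < c)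
    (hcoer : ∀ w, c * ‖w‖ ^ 2 ≤ (h w w).re + μ * ‖J w‖ ^ 2)
    (hT : ∀ u f : H, (∃ hu : u ∈ T.domain, T ⟨u, hu⟩ = f) ↔
      ∃ w, J w = u ∧ ∀ v, h v w = inner ℂ (J v) f) :
    HasDiscreteSpectrum T := by
  set Q := InnerProductSpace.continuousLinearMapOfBilin h
  -- `P` represents the shifted form. Coercivity makes it invertible (Lax–Milgram), and the
  -- resolvent is `J P⁻¹ J*`, compact because `J` is.
  set P : W →L[ℂ] W := Q + (μ : ℂ) • (ContinuousLinearMap.adjoint J ∘L J)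
  have hP : ∀ v w, inner ℂ (P v) w = h v w + μ * inner ℂ (J v) (J w) := by
    intro v w
    simp only [P, Q, add_apply, smul_apply,
      ContinuousLinearMap.comp_apply, inner_add_left, inner_smul_left,
      InnerProductSpace.continuousLinearMapOfBilin_apply, ContinuousLinearMap.adjoint_inner_left]
    simp
  have hPs : ∀ v w, inner ℂ (P v) w = inner ℂ v (P w) := by
    intro v w
    rw [← inner_conj_symm v, hP, hP, hherm v w]
    simp
  have hunit : IsUnit P := by
    refine ContinuousLinearMap.isUnit_of_forall_le_norm_inner_map P
      (c := ⟨c, hc.le⟩) (by exact_mod_cast hc) fun w => ?_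
    have h1 : c * ‖w‖ ^ 2 ≤ (inner ℂ (P w) w).re := by
      rw [hP, inner_self_eq_norm_sq_to_K]
      have := hcoer w
      simpa [← Complex.ofReal_pow] using this
    change ‖w‖ ^ 2 * c ≤ _
    rw [mul_comm]
    exact h1.trans (Complex.re_le_norm _)
  obtain ⟨p, hp⟩ := hunit
  set S : W →L[ℂ] W := ↑p⁻¹ with hS
  have hPS : ∀ w, P (S w) = w := fun w => by
    have := DFunLike.congr_fun (p.mul_inv) w
    rw [hp] at this; exact this
  have hSP : ∀ w, S (P w) = w := fun w => by
    have := DFunLike.congr_fun (p.inv_mul) w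
    rw [hp] at this; exact this
  refine hasDiscreteSpectrum_of_compact_resolvent
    (R := J ∘L (S ∘L ContinuousLinearMap.adjoint J)) (μ := μ)
    (hJ.comp_clm (S ∘L ContinuousLinearMap.adjoint J)) ?_ fun u f => ?_
  · intro x y
    simp only [ContinuousLinearMap.coe_coe, ContinuousLinearMap.comp_apply]
    rw [← ContinuousLinearMap.adjoint_inner_right J (S _) y,
      ← ContinuousLinearMap.adjoint_inner_left J (S _) x]
    conv_lhs => rw [← hPS (ContinuousLinearMap.adjoint J y)]
    rw [← hPs, hPS]
  · rw [hT]
    simp only [ContinuousLinearMap.comp_apply]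
    have key : ∀ w, (∀ v, h v w = inner ℂ (J v) f) ↔
        P w = ContinuousLinearMap.adjoint J (f + (μ : ℂ) • J w) := by
      intro w
      constructor
      · intro hw
        refine ext_inner_left ℂ fun v => ?_
        rw [← hPs, hP, ContinuousLinearMap.adjoint_inner_right, inner_add_right, inner_smul_right,
          hw]
      · intro hw v
        have h1 : inner ℂ v (P w) = _ := congrArg (inner ℂ v) hw
        rw [← hPs, hP, ContinuousLinearMap.adjoint_inner_right, inner_add_right,
          inner_smul_right] at h1
        exact add_right_cancel h1
    constructor
    · rintro ⟨w, rfl, hw⟩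
      rw [← (key w).1 hw, hSP]
    · intro hu
      refine ⟨S (ContinuousLinearMap.adjoint J (f + (μ : ℂ) • u)), hu, ?_⟩
      rw [key, hPS, hu]

end Abstract

/-! ### A sharp one-dimensional energy inequality -/

/-- Among functions with given end values the energy is least for the solution `G` of `G'' = k² G`,
and the left side is `sinh` times that minimum. The comparison is pointwise: `ζ² + k² z² - ((2z - G)
G')' = (ζ - G')² + k² (z - G)²`, and the total derivative integrates to boundary terms. -/
theorem energy_lower_bound_real {z ζ : ℝ → ℝ} {p q k : ℝ} (hpq : p < q) (hk : 0 < k)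
    (hζ : IntervalIntegrable ζ volume p q) (hζ2 : IntervalIntegrable (fun t => ζ t ^ 2) volume p q)
    (hz : ∀ x ∈ Icc p q, z x = z p + ∫ t in p..x, ζ t) :
    k * ((z p ^ 2 + z q ^ 2) * Real.cosh (k * (q - p)) - 2 * (z p * z q)) ≤
      Real.sinh (k * (q - p)) * ∫ t in p..q, (ζ t ^ 2 + k ^ 2 * z t ^ 2) := by
  set s := Real.sinh (k * (q - p)) with hs
  have hspos : 0 < s := Real.sinh_pos_iff.2 (mul_pos hk (sub_pos.2 hpq))
  set Z : ℝ → ℝ := fun x => z p + ∫ t in p..x, ζ t with hZ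
  have hZp : Z p = z p := by simp [hZ]
  have hZq : Z q = z q := (hz q (right_mem_Icc.2 hpq.le)).symm
  set G : ℝ → ℝ := fun y =>
    (z p * Real.sinh (k * (q - y)) + z q * Real.sinh (k * (y - p))) / s with hG
  set G' : ℝ → ℝ := fun y =>
    k * (-(z p * Real.cosh (k * (q - y))) + z q * Real.cosh (k * (y - p))) / s with hG'
  have hd1 : ∀ y, HasDerivAt (fun y => k * (q - y)) (-k) y := fun y => by
    simpa using ((hasDerivAt_id y).const_sub q).const_mul k
  have hd2 : ∀ y, HasDerivAt (fun y => k * (y - p)) k y := fun y => by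
    simpa using ((hasDerivAt_id y).sub_const p).const_mul k
  have hGd : ∀ y, HasDerivAt G (G' y) y := fun y => by
    convert! ((((hd1 y).sinh).const_mul (z p)).add (((hd2 y).sinh).const_mul (z q))).div_const s
      using 1
    simp only [hG']; ring
  have hGd' : ∀ y, HasDerivAt G' (k ^ 2 * G y) y := fun y => by
    convert! (((((hd1 y).cosh).const_mul (z p)).neg.add
      (((hd2 y).cosh).const_mul (z q))).const_mul k).div_const s using 1
    simp only [hG]; ring
  have hGc : Continuous G := continuous_iff_continuousAt.2 fun y => (hGd y).continuousAt
  have hGc' : Continuous G' := continuous_iff_continuousAt.2 fun y => (hGd' y).continuousAt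
  have hac : ∀ (f f' : ℝ → ℝ), (∀ y, HasDerivAt f (f' y) y) → Continuous f' →
      AbsolutelyContinuousOnInterval f p q := fun f f' h hc =>
    ContDiffOn.absolutelyContinuousOnInterval
      (contDiff_one_iff_deriv.2 ⟨fun y => (h y).differentiableAt, by
        rw [show deriv f = f' from funext fun y => (h y).deriv]; exact hc⟩).contDiffOn
  have hGac := hac G G' hGd hGc'
  have hGac' := hac G' _ hGd' (hGc.const_mul _)
  have hIac := hζ.absolutelyContinuousOnInterval_intervalIntegral (c := p) left_mem_uIcc
  have hcac : AbsolutelyContinuousOnInterval (fun _ : ℝ => z p) p q :=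
    (LipschitzWith.const (z p)).lipschitzOnWith.absolutelyContinuousOnInterval
  have hZac : AbsolutelyContinuousOnInterval Z p q := hcac.add hIac
  have hZd : ∀ᵐ y, y ∈ Ioc p q → HasDerivAt Z (ζ y) y := by
    filter_upwards [hζ.ae_hasDerivAt_integral] with y hy hy'
    refine (hy ?_ p left_mem_uIcc).const_add (z p)
    rw [uIcc_of_le hpq.le]; exact Ioc_subset_Icc_self hy'
  set F : ℝ → ℝ := (2 : ℝ) • Z - G
  have hFac : AbsolutelyContinuousOnInterval F p q := (hZac.const_smul (2 : ℝ)).sub hGac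
  have hkey := hFac.integral_deriv_mul_eq_sub hGac'
  have hbd : F q * G' q - F p * G' p =
      k * ((z p ^ 2 + z q ^ 2) * Real.cosh (k * (q - p)) - 2 * (z p * z q)) / s := by
    have e1 : G q = z q := by simp [hG, ← hs, hspos.ne']
    have e2 : G p = z p := by simp [hG, ← hs, hspos.ne']
    have e3 : F q = z q := by simp [F, e1, hZq]; ring
    have e4 : F p = z p := by simp [F, e2, hZp]; ring
    rw [e3, e4]
    simp only [hG', sub_self, mul_zero, Real.cosh_zero]
    ring
  have hmono : ∫ x in p..q, (deriv F x * G' x + F x * deriv G' x) ≤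
      ∫ t in p..q, (ζ t ^ 2 + k ^ 2 * z t ^ 2) := by
    have hzc : ∫ t in p..q, (ζ t ^ 2 + k ^ 2 * z t ^ 2) =
        ∫ t in p..q, (ζ t ^ 2 + k ^ 2 * Z t ^ 2) := by
      refine intervalIntegral.integral_congr fun t ht => ?_
      rw [uIcc_of_le hpq.le] at ht
      simp only [hZ]
      rw [hz t ht]
    rw [hzc]
    refine intervalIntegral.integral_mono_ae_restrict hpq.le ?_ ?_ ?_
    · refine (hFac.intervalIntegrable_deriv.mul_continuousOn hGac'.continuousOn).add
        (hGac'.intervalIntegrable_deriv.continuousOn_mul hFac.continuousOn)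
    · exact hζ2.add (((hZac.continuousOn.pow 2).intervalIntegrable).const_mul _)
    · rw [Filter.EventuallyLE, ← restrict_Ioc_eq_restrict_Icc, ae_restrict_iff' measurableSet_Ioc]
      filter_upwards [hZd] with y hy hy'
      have h1 : HasDerivAt F (2 * ζ y - G' y) y := by
        simpa using ((hy hy').const_smul (2 : ℝ)).sub (hGd y)
      rw [h1.deriv, (hGd' y).deriv]
      have h2 : F y = 2 * Z y - G y := by simp [F]
      rw [h2]
      nlinarith [sq_nonneg (ζ y - G' y), mul_nonneg (sq_nonneg k) (sq_nonneg (Z y - G y))]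
  rw [hkey, hbd, div_le_iff₀ hspos] at hmono
  linarith

/-- The real and imaginary parts decouple; the real inequality is added for both. -/
theorem energy_lower_bound {z ζ : ℝ → ℂ} {p q k : ℝ} (hpq : p < q) (hk : 0 < k)
    (hζ : IntervalIntegrable ζ volume p q)
    (hζ2 : IntervalIntegrable (fun t => ‖ζ t‖ ^ 2) volume p q)
    (hz : ∀ x ∈ Icc p q, z x = z p + ∫ t in p..x, ζ t) :
    k * ((‖z p‖ ^ 2 + ‖z q‖ ^ 2) * Real.cosh (k * (q - p))
        - 2 * (starRingEnd ℂ (z p) * z q).re) ≤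
      Real.sinh (k * (q - p)) * ∫ t in p..q, (‖ζ t‖ ^ 2 + k ^ 2 * ‖z t‖ ^ 2) := by
  have hsub : ∀ x ∈ Icc p q, IntervalIntegrable ζ volume p x := fun x hx =>
    hζ.mono_set (by rw [uIcc_of_le hpq.le, uIcc_of_le hx.1]; exact Icc_subset_Icc_right hx.2)
  have hre : ∀ x ∈ Icc p q, (z x).re = (z p).re + ∫ t in p..x, (ζ t).re := by
    intro x hx
    have h := Complex.reCLM.intervalIntegral_comp_comm (hsub x hx)
    simp only [Complex.reCLM_apply] at h
    rw [h, ← Complex.add_re, ← hz x hx]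
  have him : ∀ x ∈ Icc p q, (z x).im = (z p).im + ∫ t in p..x, (ζ t).im := by
    intro x hx
    have h := Complex.imCLM.intervalIntegral_comp_comm (hsub x hx)
    simp only [Complex.imCLM_apply] at h
    rw [h, ← Complex.add_im, ← hz x hx]
  have hire : IntervalIntegrable (fun t => (ζ t).re) volume p q :=
    ⟨Complex.reCLM.integrable_comp hζ.1, Complex.reCLM.integrable_comp hζ.2⟩
  have hiim : IntervalIntegrable (fun t => (ζ t).im) volume p q :=
    ⟨Complex.imCLM.integrable_comp hζ.1, Complex.imCLM.integrable_comp hζ.2⟩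
  have hnorm : ∀ w : ℂ, ‖w‖ ^ 2 = w.re ^ 2 + w.im ^ 2 := fun w => by
    rw [← Complex.normSq_eq_norm_sq, Complex.normSq_apply]; ring
  have hire2 : IntervalIntegrable (fun t => (ζ t).re ^ 2) volume p q := by
    refine hζ2.mono_fun (hire.def'.aestronglyMeasurable.pow 2)
      (Filter.Eventually.of_forall fun t => ?_)
    beta_reduce
    rw [norm_pow, norm_pow, norm_norm, Real.norm_eq_abs, sq_abs, hnorm]
    nlinarith [sq_nonneg (ζ t).im]
  have hiim2 : IntervalIntegrable (fun t => (ζ t).im ^ 2) volume p q := by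
    refine hζ2.mono_fun (hiim.def'.aestronglyMeasurable.pow 2)
      (Filter.Eventually.of_forall fun t => ?_)
    beta_reduce
    rw [norm_pow, norm_pow, norm_norm, Real.norm_eq_abs, sq_abs, hnorm]
    nlinarith [sq_nonneg (ζ t).re]
  have h1 := energy_lower_bound_real (z := fun t => (z t).re) hpq hk hire hire2 hre
  have h2 := energy_lower_bound_real (z := fun t => (z t).im) hpq hk hiim hiim2 him
  have hcont : ContinuousOn z (uIcc p q) := by
    have : ContinuousOn (fun x => z p + ∫ t in p..x, ζ t) (uIcc p q) :=
      continuousOn_const.add (intervalIntegral.continuousOn_primitive_interval'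
        hζ left_mem_uIcc)
    refine this.congr fun x hx => hz x ?_
    rwa [uIcc_of_le hpq.le] at hx
  have hsplit : ∫ t in p..q, (‖ζ t‖ ^ 2 + k ^ 2 * ‖z t‖ ^ 2) =
      (∫ t in p..q, ((ζ t).re ^ 2 + k ^ 2 * (z t).re ^ 2)) +
      ∫ t in p..q, ((ζ t).im ^ 2 + k ^ 2 * (z t).im ^ 2) := by
    rw [← intervalIntegral.integral_add]
    · congr 1
      ext t
      rw [hnorm, hnorm]; ring
    · exact hire2.add ((((Complex.continuous_re.comp_continuousOn hcont).pow
        2).intervalIntegrable).const_mul _)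
    · exact hiim2.add ((((Complex.continuous_im.comp_continuousOn hcont).pow
        2).intervalIntegrable).const_mul _)
  rw [hsplit, mul_add]
  refine le_trans (le_of_eq ?_) (add_le_add h1 h2)
  rw [hnorm, hnorm]
  simp only [Complex.mul_re, Complex.conj_re, Complex.conj_im]
  ring

/-- The diagonal of the Green function of `-d²/dx² + k²` with quasi-periodic boundary conditions
bounds point values by the energy. -/
theorem twisted_energy_lower_bound {z ζ : ℝ → ℂ} {L k θ x : ℝ} (hx : x ∈ Ioo 0 L) (hk : 0 < k)
    (hζ : IntervalIntegrable ζ volume 0 L)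
    (hζ2 : IntervalIntegrable (fun t => ‖ζ t‖ ^ 2) volume 0 L)
    (hz : ∀ y ∈ Icc 0 L, z y = z 0 + ∫ t in (0 : ℝ)..y, ζ t)
    (htw : z L = Complex.exp (θ * Complex.I) * z 0) :
    2 * k * (Real.cosh (k * L) - Real.cos θ) * ‖z x‖ ^ 2 ≤
      Real.sinh (k * L) * ∫ t in (0 : ℝ)..L, (‖ζ t‖ ^ 2 + k ^ 2 * ‖z t‖ ^ 2) := by
  have hL : 0 < L := hx.1.trans hx.2
  have hxI : x ∈ Icc 0 L := Ioo_subset_Icc_self hx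
  have hs1 : uIcc 0 x ⊆ uIcc 0 L := by
    rw [uIcc_of_le hL.le, uIcc_of_le hx.1.le]; exact Icc_subset_Icc_right hx.2.le
  have hs2 : uIcc x L ⊆ uIcc 0 L := by
    rw [uIcc_of_le hL.le, uIcc_of_le hx.2.le]; exact Icc_subset_Icc_left hx.1.le
  have hcont : ContinuousOn z (uIcc 0 L) := by
    have : ContinuousOn (fun x => z 0 + ∫ t in (0 : ℝ)..x, ζ t) (uIcc 0 L) :=
      continuousOn_const.add (intervalIntegral.continuousOn_primitive_interval'
        hζ left_mem_uIcc)
    refine this.congr fun x hx => hz x ?_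
    rwa [uIcc_of_le hL.le] at hx
  have hint : IntervalIntegrable (fun t => ‖ζ t‖ ^ 2 + k ^ 2 * ‖z t‖ ^ 2) volume 0 L :=
    hζ2.add (((hcont.norm.pow 2).intervalIntegrable).const_mul _)
  -- The interval is split at `x`: the energy on each side is at least the minimum for its end
  -- values.
  have e1 := energy_lower_bound hx.1 hk (hζ.mono_set hs1) (hζ2.mono_set hs1)
    (fun y hy => hz y ⟨hy.1, hy.2.trans hx.2.le⟩)
  have e2 := energy_lower_bound (z := z) hx.2 hk (hζ.mono_set hs2) (hζ2.mono_set hs2) (fun y hy => by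
    rw [hz y ⟨hx.1.le.trans hy.1, hy.2⟩, hz x hxI, add_assoc,
      intervalIntegral.integral_add_adjacent_intervals (hζ.mono_set hs1)]
    refine hζ.mono_set ?_
    rw [uIcc_of_le hL.le, uIcc_of_le hy.1]
    exact Icc_subset_Icc hx.1.le hy.2)
  rw [← intervalIntegral.integral_add_adjacent_intervals (hint.mono_set hs1) (hint.mono_set hs2)]
  set I1 := ∫ t in (0 : ℝ)..x, (‖ζ t‖ ^ 2 + k ^ 2 * ‖z t‖ ^ 2)
  set I2 := ∫ t in x..L, (‖ζ t‖ ^ 2 + k ^ 2 * ‖z t‖ ^ 2)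
  have hkx : k * L = k * (x - 0) + k * (L - x) := by ring
  have s1pos : 0 < Real.sinh (k * (x - 0)) :=
    Real.sinh_pos_iff.2 (mul_pos hk (sub_pos.2 hx.1))
  have s2pos : 0 < Real.sinh (k * (L - x)) :=
    Real.sinh_pos_iff.2 (mul_pos hk (sub_pos.2 hx.2))
  rw [hkx, Real.cosh_add, Real.sinh_add]
  have hc1 := Real.cosh_sq (k * (x - 0))
  have hc2 := Real.cosh_sq (k * (L - x))
  have c1pos := Real.cosh_pos (k * (x - 0))
  have c2pos := Real.cosh_pos (k * (L - x))
  set s1 := Real.sinh (k * (x - 0))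
  set s2 := Real.sinh (k * (L - x))
  set c1 := Real.cosh (k * (x - 0))
  set c2 := Real.cosh (k * (L - x))
  set A := z x
  set C := z 0
  -- Adding `s2` times the first estimate and `s1` times the second, the twist condition merges the
  -- two cross terms into the real part of `conj A * C * n`.
  set n : ℂ := s2 + Complex.exp (θ * Complex.I) * s1 with hn
  have hnn : ‖n‖ ^ 2 = s2 ^ 2 + s1 ^ 2 + 2 * s1 * s2 * Real.cos θ := by
    rw [← Complex.normSq_eq_norm_sq, Complex.normSq_apply, hn]
    simp only [Complex.add_re, Complex.add_im, Complex.mul_re, Complex.mul_im, Complex.ofReal_re,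
      Complex.ofReal_im, Complex.exp_ofReal_mul_I_re, Complex.exp_ofReal_mul_I_im]
    linear_combination s1 ^ 2 * (Real.sin_sq_add_cos_sq θ)
  have hcross : s2 * (starRingEnd ℂ C * A).re + s1 * (starRingEnd ℂ A * z L).re ≤
      ‖A‖ * ‖C‖ * ‖n‖ := by
    have h1 : s2 * (starRingEnd ℂ C * A).re + s1 * (starRingEnd ℂ A * z L).re =
        (starRingEnd ℂ A * C * n).re := by
      rw [htw, hn]
      simp only [Complex.add_re, Complex.add_im, Complex.mul_re, Complex.mul_im, Complex.ofReal_re,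
        Complex.ofReal_im, Complex.conj_re, Complex.conj_im]
      ring
    rw [h1]
    refine (Complex.re_le_norm _).trans (le_of_eq ?_)
    rw [norm_mul, norm_mul, RCLike.norm_conj]
  have hzL : ‖z L‖ = ‖C‖ := by
    rw [htw, norm_mul, Complex.norm_exp_ofReal_mul_I, one_mul]
  rw [hzL] at e2
  set S := s1 * c2 + c1 * s2 with hS
  have hSpos : 0 < S := by positivity
  have h3 : k * ((‖C‖ ^ 2 + ‖A‖ ^ 2) * S - 2 * (‖A‖ * ‖C‖ * ‖n‖)) ≤ s1 * s2 * (I1 + I2) := by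
    have h4 := mul_le_mul_of_nonneg_left e1 s2pos.le
    have h5 := mul_le_mul_of_nonneg_left e2 s1pos.le
    have h6 := mul_le_mul_of_nonneg_left hcross hk.le
    rw [hS]
    linarith
  -- Completing the square eliminates the unknown boundary value `C`. Here `S = sinh(kL)`.
  have h7 : ‖A‖ ^ 2 * (S ^ 2 - ‖n‖ ^ 2) ≤ S * ((‖C‖ ^ 2 + ‖A‖ ^ 2) * S - 2 * (‖A‖ * ‖C‖ * ‖n‖)) := by
    linarith [sq_nonneg (S * ‖C‖ - ‖A‖ * ‖n‖)]
  have h8 : S ^ 2 - ‖n‖ ^ 2 = 2 * (s1 * s2) * (c1 * c2 + s1 * s2 - Real.cos θ) := by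
    rw [hnn, hS]
    linear_combination s1 ^ 2 * hc2 + s2 ^ 2 * hc1
  rw [h8] at h7
  have h9 := mul_le_mul_of_nonneg_left h3 hSpos.le
  have h10 := mul_le_mul_of_nonneg_left h7 hk.le
  have hss : 0 < s1 * s2 := mul_pos s1pos s2pos
  refine le_of_mul_le_mul_left ?_ hss
  linarith

/-! ### The constant `K(α)` -/

/-- The sine vanishes only when `2α` is an integer: fractional part `0` is excluded by `hα`, and
`1/2` belongs to the branch with value `1`. -/
theorem magneticConst_pos {α : ℝ} (hα : ∀ n : ℤ, α ≠ n) : 0 < magneticConst α := by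
  unfold magneticConst
  split_ifs with h
  · exact one_pos
  · have hf0 : 0 < Int.fract α := Int.fract_pos.2 (hα _)
    have hf1 := Int.fract_lt_one α
    refine inv_pos.2 (abs_pos.2 fun h0 => ?_)
    rw [Real.sin_eq_zero_iff] at h0
    obtain ⟨n, hn⟩ := h0
    have h1 : (n : ℝ) = 2 * α := by
      have := Real.pi_pos.ne'
      field_simp at hn
      linarith
    have h2 : Int.fract α = ((n - 2 * ⌊α⌋ : ℤ) : ℝ) / 2 := by
      push_cast
      rw [h1, Int.fract]; ring
    have h3 : (0 : ℝ) < ((n - 2 * ⌊α⌋ : ℤ) : ℝ) := by linarith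
    have h4 : ((n - 2 * ⌊α⌋ : ℤ) : ℝ) < 2 := by linarith
    have h5 : n - 2 * ⌊α⌋ = 1 := by
      have h3' : 0 < n - 2 * ⌊α⌋ := by exact_mod_cast h3
      have h4' : n - 2 * ⌊α⌋ < 2 := by exact_mod_cast h4
      omega
    rw [h5] at h2
    exact h (by rw [h2]; norm_num)

/-- In the middle range the cosine is nonpositive and `sinh t < cosh t` suffices. Elsewhere
Cauchy–Schwarz for `(sinh t, 1)` and `(|sin|, cos)` gives `sinh t |sin| + cos ≤ cosh t`. -/
theorem sinh_le_magneticConst_mul {α : ℝ} (hα : ∀ n : ℤ, α ≠ n) (t : ℝ) :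
    Real.sinh t ≤ magneticConst α * (Real.cosh t - Real.cos (2 * Real.pi * α)) := by
  have hpos := magneticConst_pos hα
  unfold magneticConst at hpos ⊢
  split_ifs at hpos ⊢ with h
  · have hcos : Real.cos (2 * Real.pi * α) ≤ 0 := by
      have h1 : Real.cos (2 * Real.pi * α) = Real.cos (2 * Real.pi * Int.fract α) := by
        rw [Int.fract, mul_sub, mul_comm (2 * Real.pi) (⌊α⌋ : ℝ), Real.cos_sub_int_mul_two_pi]
      rw [h1]
      have := Real.pi_pos
      refine Real.cos_nonpos_of_pi_div_two_le_of_le ?_ ?_ <;> nlinarith [h.1, h.2]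
    linarith [Real.sinh_lt_cosh t]
  · have hs : 0 < |Real.sin (2 * Real.pi * α)| := inv_pos.1 hpos
    rw [inv_mul_eq_div, le_div_iff₀ hs]
    have h1 : Real.sinh t * |Real.sin (2 * Real.pi * α)| + Real.cos (2 * Real.pi * α) ≤
        Real.cosh t := by
      refine le_of_sq_le_sq ?_ (Real.cosh_pos t).le
      rw [Real.cosh_sq]
      have h2 := Real.sin_sq_add_cos_sq (2 * Real.pi * α)
      rw [← sq_abs (Real.sin _)] at h2
      nlinarith [sq_nonneg (Real.sinh t * Real.cos (2 * Real.pi * α)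
        - |Real.sin (2 * Real.pi * α)|)]
    linarith

section

variable {M : ℕ} {a : ℝ → ℝ}

/-! ### The gauge transformation -/

theorem two_pi_nonneg : (0 : ℝ) ≤ 2 * Real.pi := by positivity

theorem phase_zero (a : ℝ → ℝ) : phase a 0 = 1 := by simp [phase]

theorem phase_mul_phase_neg (a : ℝ → ℝ) (x : ℝ) : phase a x * phase (-a) x = 1 := by
  rw [phase, phase, ← Complex.exp_add]
  simp [intervalIntegral.integral_neg]

theorem phase_neg_mul_phase (a : ℝ → ℝ) (x : ℝ) : phase (-a) x * phase a x = 1 := by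
  rw [mul_comm, phase_mul_phase_neg]

theorem phase_continuousOn (ha : IntegrableOn a (Ioc 0 (2 * Real.pi))) :
    ContinuousOn (phase a) (Icc 0 (2 * Real.pi)) := by
  have := (phase_ac ha).continuousOn
  rwa [uIcc_of_le two_pi_nonneg] at this

theorem phase_aestronglyMeasurable (ha : IntegrableOn a (Ioc 0 (2 * Real.pi))) :
    AEStronglyMeasurable (phase a) circleMeasure :=
  ((phase_continuousOn ha).mono Ioc_subset_Icc_self).aestronglyMeasurable measurableSet_Ioc

/-- The derivative (up to a factor) of the gauge transform of a function `u` with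
`i u' - a u = g`. -/
def gaugedDeriv (a : ℝ → ℝ) (g : L2Circle M) (t : ℝ) : EuclideanSpace ℂ (Fin M) :=
  -(Complex.I • phase (-a) t • g t)

theorem norm_gaugedDeriv (g : L2Circle M) (t : ℝ) : ‖gaugedDeriv a g t‖ = ‖g t‖ := by
  simp [gaugedDeriv, norm_smul, norm_phase]

theorem gaugedDeriv_aestronglyMeasurable (ha : IntegrableOn a (Ioc 0 (2 * Real.pi)))
    (g : L2Circle M) : AEStronglyMeasurable (gaugedDeriv a g) circleMeasure :=
  (((phase_aestronglyMeasurable ha.neg).smul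
    (Lp.memLp g).aestronglyMeasurable).const_smul Complex.I).neg

theorem gaugedDeriv_memLp (ha : IntegrableOn a (Ioc 0 (2 * Real.pi))) (g : L2Circle M) :
    MemLp (gaugedDeriv a g) 2 circleMeasure :=
  (Lp.memLp g).of_le (gaugedDeriv_aestronglyMeasurable ha g)
    (Filter.Eventually.of_forall fun t => (norm_gaugedDeriv g t).le)

theorem gaugedDeriv_intervalIntegrable (ha : IntegrableOn a (Ioc 0 (2 * Real.pi)))
    (g : L2Circle M) : IntervalIntegrable (gaugedDeriv a g) volume 0 (2 * Real.pi) :=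
  (intervalIntegrable_iff_integrableOn_Ioc_of_le two_pi_nonneg).2
    ((gaugedDeriv_memLp ha g).integrable (by norm_num))

/-- The gauge transform of the function `u` with `i u' - a u = g` and `u 0 = c`. -/
def gauged (a : ℝ → ℝ) (c : EuclideanSpace ℂ (Fin M)) (g : L2Circle M) (x : ℝ) :
    EuclideanSpace ℂ (Fin M) :=
  c + ∫ t in (0 : ℝ)..x, gaugedDeriv a g t

theorem gauged_zero (c : EuclideanSpace ℂ (Fin M)) (g : L2Circle M) : gauged a c g 0 = c := by
  simp [gauged]

theorem gaugedDeriv_add_ae (g g' : L2Circle M) :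
    gaugedDeriv a (g + g') =ᵐ[circleMeasure] gaugedDeriv a g + gaugedDeriv a g' := by
  filter_upwards [Lp.coeFn_add g g'] with t ht
  simp only [gaugedDeriv, ht, Pi.add_apply, smul_add, neg_add]

theorem gaugedDeriv_smul_ae (r : ℂ) (g : L2Circle M) :
    gaugedDeriv a (r • g) =ᵐ[circleMeasure] r • gaugedDeriv a g := by
  filter_upwards [Lp.coeFn_smul r g] with t ht
  simp only [gaugedDeriv, ht, Pi.smul_apply, smul_neg]
  rw [smul_comm r, smul_comm r]

theorem intervalIntegral_congr_circle {f g : ℝ → EuclideanSpace ℂ (Fin M)}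
    (h : f =ᵐ[circleMeasure] g) {x : ℝ} (hx : x ∈ Icc 0 (2 * Real.pi)) :
    ∫ t in (0 : ℝ)..x, f t = ∫ t in (0 : ℝ)..x, g t := by
  refine intervalIntegral.integral_congr_ae_restrict ?_
  rw [uIoc_of_le hx.1]
  exact ae_mono (Measure.restrict_mono (Ioc_subset_Ioc_right hx.2) le_rfl) h

theorem gaugedDeriv_intervalIntegrable' (ha : IntegrableOn a (Ioc 0 (2 * Real.pi)))
    (g : L2Circle M) {x y : ℝ} (hx : x ∈ Icc 0 (2 * Real.pi)) (hy : y ∈ Icc 0 (2 * Real.pi)) :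
    IntervalIntegrable (gaugedDeriv a g) volume x y := by
  refine (gaugedDeriv_intervalIntegrable ha g).mono_set ?_
  rw [uIcc_of_le two_pi_nonneg]
  exact uIcc_subset_Icc hx hy

theorem zero_mem_circle : (0 : ℝ) ∈ Icc 0 (2 * Real.pi) := left_mem_Icc.2 two_pi_nonneg

theorem two_pi_mem_circle : 2 * Real.pi ∈ Icc 0 (2 * Real.pi) := right_mem_Icc.2 two_pi_nonneg

theorem gauged_add (ha : IntegrableOn a (Ioc 0 (2 * Real.pi))) (c c' : EuclideanSpace ℂ (Fin M))
    (g g' : L2Circle M) {x : ℝ} (hx : x ∈ Icc 0 (2 * Real.pi)) :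
    gauged a (c + c') (g + g') x = gauged a c g x + gauged a c' g' x := by
  simp only [gauged]
  rw [intervalIntegral_congr_circle (gaugedDeriv_add_ae g g') hx]
  simp only [Pi.add_apply]
  rw [intervalIntegral.integral_add (gaugedDeriv_intervalIntegrable' ha g zero_mem_circle hx)
    (gaugedDeriv_intervalIntegrable' ha g' zero_mem_circle hx)]
  abel

theorem gauged_smul (r : ℂ) (c : EuclideanSpace ℂ (Fin M)) (g : L2Circle M) {x : ℝ}
    (hx : x ∈ Icc 0 (2 * Real.pi)) : gauged a (r • c) (r • g) x = r • gauged a c g x := by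
  simp only [gauged]
  rw [intervalIntegral_congr_circle (gaugedDeriv_smul_ae r g) hx]
  simp only [Pi.smul_apply]
  rw [intervalIntegral.integral_smul, smul_add]

/-- Cauchy–Schwarz on `(x, y]`. The resulting Hölder modulus depends on `g` only through its norm,
which yields equicontinuity on balls. -/
theorem norm_intervalIntegral_gaugedDeriv_le (ha : IntegrableOn a (Ioc 0 (2 * Real.pi)))
    (g : L2Circle M) {x y : ℝ} (hx : 0 ≤ x) (hxy : x ≤ y) (hy : y ≤ 2 * Real.pi) :
    ‖∫ t in x..y, gaugedDeriv a g t‖ ≤ ‖g‖ * Real.sqrt (y - x) := by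
  have hmono : volume.restrict (Ioc x y) ≤ circleMeasure :=
    Measure.restrict_mono (Ioc_subset_Ioc hx hy) le_rfl
  have hmem : MemLp (gaugedDeriv a g) 2 (volume.restrict (Ioc x y)) :=
    (gaugedDeriv_memLp ha g).mono_measure hmono
  have h1 : eLpNorm (gaugedDeriv a g) 1 (volume.restrict (Ioc x y)) ≤
      ENNReal.ofReal (‖g‖ * Real.sqrt (y - x)) := by
    refine (eLpNorm_le_eLpNorm_mul_rpow_measure_univ (p := 1) (q := 2) (by norm_num)
      hmem.aestronglyMeasurable).trans ?_
    rw [ENNReal.ofReal_mul (norm_nonneg _)]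
    refine mul_le_mul' ?_ ?_
    · refine (eLpNorm_mono_measure _ hmono).trans ?_
      rw [eLpNorm_congr_norm_ae (g := g)
        (Filter.Eventually.of_forall fun t => norm_gaugedDeriv g t), ← Lp.enorm_def,
        ofReal_norm]
    · rw [Measure.restrict_apply_univ, Real.volume_Ioc, Real.sqrt_eq_rpow,
        ENNReal.ofReal_rpow_of_nonneg (sub_nonneg.2 hxy) (by norm_num)]
      norm_num
  rw [intervalIntegral.integral_of_le hxy]
  have h2 : ‖∫ t in Ioc x y, gaugedDeriv a g t‖ₑ ≤ ENNReal.ofReal (‖g‖ * Real.sqrt (y - x)) := by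
    refine (enorm_integral_le_lintegral_enorm _).trans ?_
    rwa [← eLpNorm_one_eq_lintegral_enorm]
  rw [← ofReal_norm] at h2
  exact (ENNReal.ofReal_le_ofReal_iff (by positivity)).1 h2

theorem norm_gauged_sub_le (ha : IntegrableOn a (Ioc 0 (2 * Real.pi)))
    (c : EuclideanSpace ℂ (Fin M)) (g : L2Circle M) {x y : ℝ} (hx : x ∈ Icc 0 (2 * Real.pi))
    (hy : y ∈ Icc 0 (2 * Real.pi)) :
    ‖gauged a c g y - gauged a c g x‖ ≤ ‖g‖ * Real.sqrt |y - x| := by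
  have hd : ∀ {x y}, x ∈ Icc 0 (2 * Real.pi) → y ∈ Icc 0 (2 * Real.pi) →
      gauged a c g y - gauged a c g x = ∫ t in x..y, gaugedDeriv a g t := by
    intro x y hx hy
    simp only [gauged]
    rw [add_sub_add_left_eq_sub, intervalIntegral.integral_interval_sub_left
      (gaugedDeriv_intervalIntegrable' ha g zero_mem_circle hy)
      (gaugedDeriv_intervalIntegrable' ha g zero_mem_circle hx)]
  rcases le_total x y with h | h
  · rw [hd hx hy, abs_of_nonneg (sub_nonneg.2 h)]
    exact norm_intervalIntegral_gaugedDeriv_le ha g hx.1 h hy.2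
  · rw [norm_sub_rev, hd hy hx, abs_sub_comm, abs_of_nonneg (sub_nonneg.2 h)]
    exact norm_intervalIntegral_gaugedDeriv_le ha g hy.1 h hx.2

theorem norm_gauged_le (ha : IntegrableOn a (Ioc 0 (2 * Real.pi)))
    (c : EuclideanSpace ℂ (Fin M)) (g : L2Circle M) {x y : ℝ} (hx : x ∈ Icc 0 (2 * Real.pi))
    (hy : y ∈ Icc 0 (2 * Real.pi)) :
    ‖gauged a c g y‖ ≤ ‖gauged a c g x‖ + ‖g‖ * Real.sqrt (2 * Real.pi) := by
  have h1 : ‖gauged a c g y‖ ≤ ‖gauged a c g x‖ + ‖gauged a c g y - gauged a c g x‖ := by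
    conv_lhs => rw [← add_sub_cancel (gauged a c g x) (gauged a c g y)]
    exact norm_add_le _ _
  refine h1.trans (add_le_add le_rfl ((norm_gauged_sub_le ha c g hx hy).trans ?_))
  refine mul_le_mul_of_nonneg_left (Real.sqrt_le_sqrt ?_) (norm_nonneg _)
  rw [abs_le]
  constructor <;> linarith [hx.1, hx.2, hy.1, hy.2]

theorem continuousOn_gauged (ha : IntegrableOn a (Ioc 0 (2 * Real.pi)))
    (c : EuclideanSpace ℂ (Fin M)) (g : L2Circle M) :
    ContinuousOn (gauged a c g) (Icc 0 (2 * Real.pi)) := by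
  have := intervalIntegral.continuousOn_primitive_interval'
    (gaugedDeriv_intervalIntegrable ha g) left_mem_uIcc
  rw [uIcc_of_le two_pi_nonneg] at this
  exact continuousOn_const.add this

/-- Increments of the vector-valued primitive are dominated by those of the real primitive of `‖f‖`.
-/
theorem absolutelyContinuousOnInterval_primitive {E : Type*} [NormedAddCommGroup E]
    [NormedSpace ℝ E] {f : ℝ → E} {p q : ℝ}
    (hf : IntervalIntegrable f volume p q) :
    AbsolutelyContinuousOnInterval (fun x => ∫ t in p..x, f t) p q := by
  have h := hf.norm.absolutelyContinuousOnInterval_intervalIntegral (c := p) left_mem_uIcc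
  have hle : ∀ x ∈ uIcc p q, ∀ y ∈ uIcc p q,
      dist (∫ t in p..x, f t) (∫ t in p..y, f t) ≤
        dist (∫ t in p..x, ‖f t‖) (∫ t in p..y, ‖f t‖) := by
    intro x hx y hy
    have hi : ∀ z ∈ uIcc p q, IntervalIntegrable f volume p z := fun z hz =>
      hf.mono_set (uIcc_subset_uIcc left_mem_uIcc hz)
    rw [dist_eq_norm, dist_eq_norm, intervalIntegral.integral_interval_sub_left (hi x hx) (hi y hy),
      intervalIntegral.integral_interval_sub_left (hi x hx).norm (hi y hy).norm]
    exact intervalIntegral.norm_integral_le_abs_integral_norm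
  refine squeeze_zero' (Filter.Eventually.of_forall fun _ =>
    Finset.sum_nonneg fun _ _ => dist_nonneg) ?_ h
  refine Filter.Eventually.filter_mono inf_le_right (Filter.eventually_principal.2 fun E hE => ?_)
  refine Finset.sum_le_sum fun i hi => ?_
  obtain ⟨h1, -⟩ := hE
  exact hle _ (h1 i hi).1 _ (h1 i hi).2

theorem gauged_ac (ha : IntegrableOn a (Ioc 0 (2 * Real.pi)))
    (c : EuclideanSpace ℂ (Fin M)) (g : L2Circle M) :
    AbsolutelyContinuousOnInterval (gauged a c g) 0 (2 * Real.pi) :=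
  ((LipschitzWith.const c).lipschitzOnWith.absolutelyContinuousOnInterval).add
    (absolutelyContinuousOnInterval_primitive (gaugedDeriv_intervalIntegrable ha g))

theorem gauged_hasDerivAt (ha : IntegrableOn a (Ioc 0 (2 * Real.pi)))
    (c : EuclideanSpace ℂ (Fin M)) (g : L2Circle M) :
    ∀ᵐ x ∂circleMeasure, HasDerivAt (gauged a c g) (gaugedDeriv a g x) x := by
  rw [ae_restrict_iff' measurableSet_Ioc]
  filter_upwards [(gaugedDeriv_intervalIntegrable ha g).ae_hasDerivAt_integral] with x hx hx'
  exact (hx (by rw [uIcc_of_le two_pi_nonneg]; exact Ioc_subset_Icc_self hx') 0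
    left_mem_uIcc).const_add c

/-- The functions in the domain of `i d/dx - a` are obtained by solving `i u' - a u = g`. -/
theorem mem_magneticDerivGraph_iff (ha : IntegrableOn a (Ioc 0 (2 * Real.pi))) (u g : L2Circle M) :
    (u, g) ∈ magneticDerivGraph M a ↔ ∃ c : EuclideanSpace ℂ (Fin M),
      phase a (2 * Real.pi) • gauged a c g (2 * Real.pi) = c ∧
      u =ᵐ[circleMeasure] fun x => phase a x • gauged a c g x := by
  constructor
  · rintro ⟨U, hU, hU0, hu, hg⟩
    simp only at hu hg
    -- The gauge removes `a`: `(phase (-a) U)' = -i phase (-a) (i U' - a U)`. Thus `w` and `gauged a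
    -- (U 0) g` have the same derivative a.e. and the same value at `0`, and absolute continuity
    -- makes them equal.
    set w : ℝ → EuclideanSpace ℂ (Fin M) := phase (-a) • U with hw
    have hwac : AbsolutelyContinuousOnInterval w 0 (2 * Real.pi) := (phase_ac ha.neg).smul hU
    have hwd : ∀ᵐ x ∂circleMeasure, HasDerivAt w (gaugedDeriv a g x) x := by
      filter_upwards [phase_hasDerivAt ha.neg, ae_differentiableAt hU, hg] with x h1 h2 h3
      convert! h1.smul h2.hasDerivAt using 1
      rw [gaugedDeriv, h3]
      simp only [Pi.neg_apply, Complex.ofReal_neg, neg_neg]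
      ext k
      simp only [PiLp.add_apply, PiLp.sub_apply, PiLp.smul_apply, PiLp.neg_apply, smul_eq_mul]
      linear_combination (-phase (-a) x * deriv U x k) * Complex.I_mul_I
    have hd : ∀ x ∈ Icc 0 (2 * Real.pi), w x = gauged a (U 0) g x := by
      have hac : AbsolutelyContinuousOnInterval (w - gauged a (U 0) g) 0 (2 * Real.pi) :=
        hwac.sub (gauged_ac ha _ _)
      have hd0 : ∀ᵐ x, x ∈ uIcc 0 (2 * Real.pi) → HasDerivAt (w - gauged a (U 0) g) 0 x := by
        have h1 : ∀ᵐ x ∂circleMeasure, HasDerivAt (w - gauged a (U 0) g) 0 x := by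
          filter_upwards [hwd, gauged_hasDerivAt ha (U 0) g] with x h1 h2
          simpa using h1.sub h2
        rw [circleMeasure, restrict_Ioc_eq_restrict_Icc, ae_restrict_iff' measurableSet_Icc] at h1
        rwa [uIcc_of_le two_pi_nonneg]
      obtain ⟨C, hC⟩ := hac.const_of_ae_hasDerivAt_zero hd0
      rw [uIcc_of_le two_pi_nonneg] at hC
      intro x hx
      have h0 := hC 0 zero_mem_circle
      have hx' := hC x hx
      simp only [Pi.sub_apply, gauged_zero, hw, Pi.smul_apply', phase_zero, one_smul,
        sub_self] at h0
      rw [← h0] at hx'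
      exact sub_eq_zero.1 hx'
    have hpw : ∀ x, phase a x • w x = U x := fun x => by
      simp only [hw, Pi.smul_apply']
      rw [smul_smul, phase_mul_phase_neg, one_smul]
    refine ⟨U 0, ?_, ?_⟩
    · rw [← hd _ two_pi_mem_circle, hpw, hU0]
    · filter_upwards [hu, ae_restrict_mem measurableSet_Ioc] with x h1 h2
      rw [h1, ← hd x (Ioc_subset_Icc_self h2), hpw]
  · rintro ⟨c, hc, hu⟩
    refine ⟨phase a • gauged a c g, (phase_ac ha).smul (gauged_ac ha c g), ?_, hu, ?_⟩
    · simp only [Pi.smul_apply', phase_zero, gauged_zero, one_smul, hc]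
    · filter_upwards [phase_hasDerivAt ha, gauged_hasDerivAt ha c g] with x h1 h2
      rw [(h1.smul h2).deriv, gaugedDeriv]
      have h3 := phase_mul_phase_neg a x
      ext k
      simp only [PiLp.add_apply, PiLp.sub_apply, PiLp.smul_apply, PiLp.neg_apply, smul_eq_mul,
        Pi.smul_apply']
      linear_combination (g x k * phase a x * phase (-a) x + phase a x * a x * gauged a c g x k) *
        Complex.I_mul_I - g x k * h3

end

section

variable {M : ℕ} {a : ℝ → ℝ}

/-! ### The form domain as a Hilbert space -/

/-- Initial value and magnetic derivative of an element of the form domain. -/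
abbrev CauchyData (M : ℕ) : Type := WithLp 2 (EuclideanSpace ℂ (Fin M) × L2Circle M)

instance : CompactSpace (Icc (0 : ℝ) (2 * Real.pi)) := isCompact_iff_compactSpace.1 isCompact_Icc

/-- The gauge transform as a continuous linear map into the continuous functions. -/
def gaugedCLM (ha : IntegrableOn a (Ioc 0 (2 * Real.pi))) :
    CauchyData M →L[ℂ] C(Icc (0 : ℝ) (2 * Real.pi), EuclideanSpace ℂ (Fin M)) :=
  LinearMap.mkContinuous
    { toFun := fun w => ⟨fun x => gauged a w.fst w.snd x,
        continuousOn_iff_continuous_domRestrict.1 (continuousOn_gauged ha w.fst w.snd)⟩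
      map_add' := fun v w => by
        ext1 x
        exact gauged_add ha v.fst w.fst v.snd w.snd x.2
      map_smul' := fun r w => by
        ext1 x
        exact gauged_smul r w.fst w.snd x.2 }
    (1 + Real.sqrt (2 * Real.pi)) fun w => by
      refine (ContinuousMap.norm_le _ (by positivity)).2 fun x => ?_
      have h1 := norm_gauged_le ha w.fst w.snd zero_mem_circle x.2
      rw [gauged_zero] at h1
      have h2 : ‖w.fst‖ ≤ ‖w‖ := WithLp.norm_fst_le (x := w) ..
      have h3 : ‖w.snd‖ ≤ ‖w‖ := WithLp.norm_snd_le (x := w) ..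
      have h4 := mul_le_mul_of_nonneg_right h3 (Real.sqrt_nonneg (2 * Real.pi))
      change ‖gauged a w.fst w.snd x‖ ≤ _
      linarith

/-- Arzelà–Ascoli: the image of the unit ball is bounded and has the common modulus of continuity
`√|x - y|`. -/
theorem isCompactOperator_gaugedCLM (ha : IntegrableOn a (Ioc 0 (2 * Real.pi))) :
    IsCompactOperator (gaugedCLM (M := M) ha) := by
  rw [isCompactOperator_iff_exists_mem_nhds_isCompact_closure_image]
  refine ⟨Metric.ball 0 1, Metric.ball_mem_nhds _ one_pos, ?_⟩
  set e := ContinuousMap.equivBoundedOfCompact (Icc (0 : ℝ) (2 * Real.pi))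
    (EuclideanSpace ℂ (Fin M))
  set A := e '' (gaugedCLM (M := M) ha '' Metric.ball 0 1) with hA
  have hcomp : IsCompact (closure A) := by
    refine BoundedContinuousFunction.arzela_ascoli
      (Metric.closedBall (0 : EuclideanSpace ℂ (Fin M)) ‖gaugedCLM (M := M) ha‖)
      (isCompact_closedBall _ _) A ?_ ?_
    · rintro _ x ⟨_, ⟨w, hw, rfl⟩, rfl⟩
      rw [mem_closedBall_zero_iff]
      refine ((gaugedCLM ha w).norm_coe_le_norm x).trans ?_
      refine ((gaugedCLM ha).le_opNorm w).trans ?_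
      rw [mem_ball_zero_iff] at hw
      exact mul_le_of_le_one_right (norm_nonneg _) hw.le
    · refine Metric.equicontinuous_of_continuity_modulus (fun t => Real.sqrt |t|) ?_ _ ?_
      · have : Continuous fun t : ℝ => Real.sqrt |t| := by fun_prop
        simpa using this.tendsto 0
      · rintro x y ⟨_, ⟨_, ⟨w, hw, rfl⟩, rfl⟩⟩
        rw [mem_ball_zero_iff] at hw
        have h1 := norm_gauged_sub_le ha w.fst w.snd y.2 x.2
        have h2 : ‖w.snd‖ ≤ 1 := (WithLp.norm_snd_le (x := w) ..).trans hw.le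
        change dist (gauged a w.fst w.snd x) (gauged a w.fst w.snd y) ≤ _
        rw [dist_eq_norm, Subtype.dist_eq, Real.dist_eq, abs_abs]
        exact h1.trans (mul_le_of_le_one_left (Real.sqrt_nonneg _) h2)
  have hiso : Isometry e := fun f g => rfl
  have h1 : closure A = e '' closure (gaugedCLM (M := M) ha '' Metric.ball 0 1) := by
    rw [hA]
    exact ((ContinuousMap.isometryEquivBoundedOfCompact (Icc (0 : ℝ) (2 * Real.pi))
      (EuclideanSpace ℂ (Fin M))).toHomeomorph.image_closure _).symm
  rw [h1] at hcomp
  exact hiso.isEmbedding.isCompact_iff.2 hcomp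

/-- The extension by the boundary values of a continuous function, multiplied by the phase. -/
def phaseExtend (a : ℝ → ℝ) (f : C(Icc (0 : ℝ) (2 * Real.pi), EuclideanSpace ℂ (Fin M))) (x : ℝ) :
    EuclideanSpace ℂ (Fin M) :=
  phase a x • IccExtend two_pi_nonneg f x

theorem norm_phaseExtend_le (f : C(Icc (0 : ℝ) (2 * Real.pi), EuclideanSpace ℂ (Fin M))) (x : ℝ) :
    ‖phaseExtend a f x‖ ≤ ‖f‖ := by
  rw [phaseExtend, norm_smul, norm_phase, one_mul]
  exact f.norm_coe_le_norm _

theorem phaseExtend_memLp (ha : IntegrableOn a (Ioc 0 (2 * Real.pi)))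
    (f : C(Icc (0 : ℝ) (2 * Real.pi), EuclideanSpace ℂ (Fin M))) :
    MemLp (phaseExtend a f) 2 circleMeasure :=
  MemLp.of_bound ((phase_aestronglyMeasurable ha).smul
    (f.continuous.Icc_extend').aestronglyMeasurable) ‖f‖
    (Filter.Eventually.of_forall fun x => norm_phaseExtend_le f x)

/-- Multiplication by the phase, from the continuous functions to `L²`. -/
def phaseMulCLM (ha : IntegrableOn a (Ioc 0 (2 * Real.pi))) :
    C(Icc (0 : ℝ) (2 * Real.pi), EuclideanSpace ℂ (Fin M)) →L[ℂ] L2Circle M :=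
  LinearMap.mkContinuous
    { toFun := fun f => (phaseExtend_memLp ha f).toLp (phaseExtend a f)
      map_add' := fun f g => by
        rw [← MemLp.toLp_add]
        refine MemLp.toLp_congr _ _ (Filter.Eventually.of_forall fun x => ?_)
        simp [phaseExtend, IccExtend]
      map_smul' := fun r f => by
        rw [RingHom.id_apply, ← MemLp.toLp_const_smul]
        refine MemLp.toLp_congr _ _ (Filter.Eventually.of_forall fun x => ?_)
        simp only [phaseExtend, IccExtend, Pi.smul_apply, Function.comp_apply,
          ContinuousMap.coe_smul]
        rw [smul_comm] }
    (measureUnivNNReal circleMeasure ^ (2 : ENNReal).toReal⁻¹) fun f => by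
      refine Lp.norm_le_of_ae_bound (norm_nonneg _) ?_
      filter_upwards [(phaseExtend_memLp ha f).coeFn_toLp] with x hx
      change ‖(phaseExtend_memLp ha f).toLp (phaseExtend a f) x‖ ≤ _
      rw [hx]
      exact norm_phaseExtend_le f x

/-- The function with the given Cauchy data. -/
def cauchySolution (a : ℝ → ℝ) (w : CauchyData M) (x : ℝ) : EuclideanSpace ℂ (Fin M) :=
  phase a x • gauged a w.fst w.snd x

/-- The `L²` function with the given Cauchy data. -/
def solutionCLM (ha : IntegrableOn a (Ioc 0 (2 * Real.pi))) : CauchyData M →L[ℂ] L2Circle M :=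
  phaseMulCLM ha ∘L gaugedCLM ha

theorem solutionCLM_ae (ha : IntegrableOn a (Ioc 0 (2 * Real.pi))) (w : CauchyData M) :
    solutionCLM ha w =ᵐ[circleMeasure] cauchySolution a w := by
  filter_upwards [(phaseExtend_memLp ha (gaugedCLM ha w)).coeFn_toLp,
    ae_restrict_mem measurableSet_Ioc] with x hx hx'
  change (phaseExtend_memLp ha (gaugedCLM ha w)).toLp (phaseExtend a _) x = _
  rw [hx, phaseExtend, IccExtend_of_mem _ _ (Ioc_subset_Icc_self hx')]
  rfl

/-- The monodromy defect: it vanishes for the Cauchy data of periodic functions. -/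
def monodromyDefect (ha : IntegrableOn a (Ioc 0 (2 * Real.pi))) :
    CauchyData M →L[ℂ] EuclideanSpace ℂ (Fin M) :=
  phase a (2 * Real.pi) •
    (ContinuousMap.evalCLM ℂ (⟨2 * Real.pi, two_pi_mem_circle⟩ : Icc (0 : ℝ) (2 * Real.pi))
      ∘L gaugedCLM ha) - WithLp.fstL 2 ℂ _ _

/-- The form domain of the magnetic Schrödinger operator. -/
abbrev FormDomain (M : ℕ) (ha : IntegrableOn a (Ioc 0 (2 * Real.pi))) : Type :=
  (monodromyDefect (M := M) ha).ker

instance (ha : IntegrableOn a (Ioc 0 (2 * Real.pi))) : CompleteSpace (FormDomain M ha) :=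
  (monodromyDefect (M := M) ha).isClosed_ker.completeSpace_coe

variable {ha : IntegrableOn a (Ioc 0 (2 * Real.pi))}

theorem FormDomain.periodic (w : FormDomain M ha) :
    phase a (2 * Real.pi) • gauged a w.1.fst w.1.snd (2 * Real.pi) = w.1.fst :=
  sub_eq_zero.1 (LinearMap.mem_ker.1 w.2)

/-- The embedding of the form domain into `L²`. -/
def formEmbedding (M : ℕ) (ha : IntegrableOn a (Ioc 0 (2 * Real.pi))) :
    FormDomain M ha →L[ℂ] L2Circle M :=
  solutionCLM ha ∘L (monodromyDefect (M := M) ha).ker.subtypeL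

theorem formEmbedding_ae (w : FormDomain M ha) :
    formEmbedding M ha w =ᵐ[circleMeasure] cauchySolution a w.1 :=
  solutionCLM_ae ha w.1

theorem isCompactOperator_formEmbedding : IsCompactOperator (formEmbedding M ha) :=
  ((isCompactOperator_gaugedCLM ha).clm_comp (phaseMulCLM ha)).comp_clm
    (monodromyDefect (M := M) ha).ker.subtypeL

/-- Parametrizes the graph of the unbounded operator by a Hilbert space, on which the Schrödinger
form is bounded. -/
theorem magneticDeriv_iff (ha : IntegrableOn a (Ioc 0 (2 * Real.pi))) (u g : L2Circle M) :
    (∃ hu : u ∈ (magneticDeriv M a).domain, magneticDeriv M a ⟨u, hu⟩ = g) ↔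
      ∃ w : FormDomain M ha, formEmbedding M ha w = u ∧ w.1.snd = g := by
  have h1 : (∃ hu : u ∈ (magneticDeriv M a).domain, magneticDeriv M a ⟨u, hu⟩ = g) ↔
      (u, g) ∈ (magneticDeriv M a).graph := by
    rw [LinearPMap.mem_graph_iff]
    constructor
    · rintro ⟨hu, h⟩
      exact ⟨⟨u, hu⟩, rfl, h⟩
    · rintro ⟨⟨y, hy⟩, rfl, h⟩
      exact ⟨hy, h⟩
  rw [h1, magneticDeriv_graph, mem_magneticDerivGraph_iff ha]
  constructor
  · rintro ⟨c, hc, hu⟩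
    refine ⟨⟨WithLp.toLp 2 (c, g), LinearMap.mem_ker.2 (sub_eq_zero.2 hc)⟩, ?_, rfl⟩
    exact Lp.ext ((formEmbedding_ae _).trans hu.symm)
  · rintro ⟨w, rfl, rfl⟩
    exact ⟨w.1.fst, w.periodic, formEmbedding_ae w⟩

theorem formEmbedding_mem_domain (w : FormDomain M ha) :
    formEmbedding M ha w ∈ (magneticDeriv M a).domain :=
  ((magneticDeriv_iff ha _ _).2 ⟨w, rfl, rfl⟩).1

theorem magneticDeriv_formEmbedding (w : FormDomain M ha)
    (hw : formEmbedding M ha w ∈ (magneticDeriv M a).domain) :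
    magneticDeriv M a ⟨formEmbedding M ha w, hw⟩ = w.1.snd :=
  ((magneticDeriv_iff ha _ _).2 ⟨w, rfl, rfl⟩).2

theorem exists_formEmbedding_eq {u : L2Circle M} (hu : u ∈ (magneticDeriv M a).domain) :
    ∃ w : FormDomain M ha, formEmbedding M ha w = u :=
  let ⟨w, h, _⟩ := (magneticDeriv_iff ha _ _).1 ⟨hu, rfl⟩
  ⟨w, h⟩

/-! ### Pointwise bounds by the magnetic energy -/

theorem phase_two_pi (a : ℝ → ℝ) :
    phase (-a) (2 * Real.pi) = Complex.exp ((2 * Real.pi * flux a : ℝ) * Complex.I) := by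
  rw [phase, flux]
  congr 2
  have h1 : 2 * Real.pi * (1 / (2 * Real.pi) * ∫ x in (0 : ℝ)..(2 * Real.pi), a x) =
      ∫ x in (0 : ℝ)..(2 * Real.pi), a x := by
    have := Real.pi_pos.ne'
    field_simp
  rw [h1]
  simp [intervalIntegral.integral_neg]

theorem integral_norm_sq_eq (g : L2Circle M) :
    ∫ t in (0 : ℝ)..(2 * Real.pi), ‖g t‖ ^ 2 = ‖g‖ ^ 2 := by
  rw [intervalIntegral.integral_of_le two_pi_nonneg]
  have h1 : inner ℂ g g = ((‖g‖ ^ 2 : ℝ) : ℂ) := by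
    rw [inner_self_eq_norm_sq_to_K]; push_cast; rfl
  rw [L2.inner_def] at h1
  have h2 : ∀ t, inner ℂ (g t) (g t) = ((‖g t‖ ^ 2 : ℝ) : ℂ) := fun t => by
    rw [inner_self_eq_norm_sq_to_K]; push_cast; rfl
  simp_rw [h2] at h1
  rw [integral_complex_ofReal] at h1
  exact_mod_cast h1

theorem intervalIntegrable_norm_sq (g : L2Circle M) :
    IntervalIntegrable (fun t => ‖g t‖ ^ 2) volume 0 (2 * Real.pi) := by
  rw [intervalIntegrable_iff_integrableOn_Ioc_of_le two_pi_nonneg]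
  exact (Lp.memLp g).integrable_norm_pow (by norm_num)

/-- Sharp pointwise bound for the elements of the form domain by the magnetic energy. -/
theorem pointwise_energy_bound (w : FormDomain M ha) (b : EuclideanSpace ℂ (Fin M)) {x k : ℝ}
    (hx : x ∈ Ioo 0 (2 * Real.pi)) (hk : 0 < k) :
    2 * k * (Real.cosh (k * (2 * Real.pi)) - Real.cos (2 * Real.pi * flux a)) *
        ‖inner ℂ b (cauchySolution a w.1 x)‖ ^ 2 ≤
      Real.sinh (k * (2 * Real.pi)) *
        (‖b‖ ^ 2 * (‖w.1.snd‖ ^ 2 + k ^ 2 * ‖formEmbedding M ha w‖ ^ 2)) := by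
  set c := w.1.fst with hc
  set g := w.1.snd with hg
  -- The component of the gauge transform along `b` is a scalar quasi-periodic function; periodicity
  -- of `u` becomes the twist `exp(2πiα)`.
  set z : ℝ → ℂ := fun y => inner ℂ b (gauged a c g y) with hz
  set ζ : ℝ → ℂ := fun t => inner ℂ b (gaugedDeriv a g t) with hζ
  have hζL : ∀ t, ‖ζ t‖ ^ 2 ≤ ‖b‖ ^ 2 * ‖g t‖ ^ 2 := fun t => by
    rw [← mul_pow, ← norm_gaugedDeriv (a := a)]
    exact pow_le_pow_left₀ (norm_nonneg _) (norm_inner_le_norm _ _) 2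
  have hζi : IntervalIntegrable ζ volume 0 (2 * Real.pi) := by
    have := gaugedDeriv_intervalIntegrable ha g
    exact ⟨(innerSL ℂ b).integrable_comp this.1, (innerSL ℂ b).integrable_comp this.2⟩
  have hzp : ∀ y ∈ Icc 0 (2 * Real.pi), z y = z 0 + ∫ t in (0 : ℝ)..y, ζ t := by
    intro y hy
    have h1 := (innerSL ℂ b).intervalIntegral_comp_comm
      (gaugedDeriv_intervalIntegrable' ha g zero_mem_circle hy)
    simp only [innerSL_apply_apply] at h1
    simp only [hz, hζ, gauged_zero]
    rw [h1, ← inner_add_right]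
    rfl
  have hnu : ∀ᵐ t ∂circleMeasure, ‖gauged a c g t‖ = ‖formEmbedding M ha w t‖ := by
    filter_upwards [formEmbedding_ae w] with t ht
    rw [ht, cauchySolution, norm_smul, norm_phase, one_mul]
  have hζ2 : IntervalIntegrable (fun t => ‖ζ t‖ ^ 2) volume 0 (2 * Real.pi) := by
    refine ((intervalIntegrable_norm_sq g).const_mul (‖b‖ ^ 2)).mono_fun
      (hζi.def'.aestronglyMeasurable.norm.pow 2) (Filter.Eventually.of_forall fun t => ?_)
    beta_reduce
    rw [Real.norm_of_nonneg (by positivity), Real.norm_of_nonneg (by positivity)]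
    exact hζL t
  have htw : z (2 * Real.pi) =
      Complex.exp ((2 * Real.pi * flux a : ℝ) * Complex.I) * z 0 := by
    rw [← phase_two_pi]
    simp only [hz, gauged_zero]
    rw [← inner_smul_right]
    congr 1
    conv_rhs => rw [hc, ← w.periodic]
    rw [smul_smul, phase_neg_mul_phase, one_smul]
  have hmain := twisted_energy_lower_bound hx hk hζi hζ2 hzp htw
  have hval : ‖inner ℂ b (cauchySolution a w.1 x)‖ = ‖z x‖ := by
    rw [cauchySolution, inner_smul_right, norm_mul, norm_phase, one_mul]
  rw [hval]
  refine hmain.trans (mul_le_mul_of_nonneg_left ?_ (Real.sinh_nonneg_iff.2 (by positivity)))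
  have hzc : ContinuousOn z (uIcc 0 (2 * Real.pi)) := by
    rw [uIcc_of_le two_pi_nonneg]
    exact (innerSL ℂ b).continuous.comp_continuousOn (continuousOn_gauged ha c g)
  have hbd : ∫ t in (0 : ℝ)..(2 * Real.pi), (‖ζ t‖ ^ 2 + k ^ 2 * ‖z t‖ ^ 2) ≤
      ∫ t in (0 : ℝ)..(2 * Real.pi), ‖b‖ ^ 2 * (‖g t‖ ^ 2 +
        k ^ 2 * ‖formEmbedding M ha w t‖ ^ 2) := by
    refine intervalIntegral.integral_mono_ae_restrict two_pi_nonneg ?_ ?_ ?_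
    · exact hζ2.add (((hzc.norm.pow 2).intervalIntegrable).const_mul _)
    · exact ((intervalIntegrable_norm_sq g).add
        ((intervalIntegrable_norm_sq _).const_mul _)).const_mul _
    · rw [← restrict_Ioc_eq_restrict_Icc]
      filter_upwards [hnu] with t ht
      rw [mul_add, ← ht]
      refine add_le_add (hζL t) ?_
      have h1 : ‖z t‖ ^ 2 ≤ (‖b‖ * ‖gauged a c g t‖) ^ 2 :=
        pow_le_pow_left₀ (norm_nonneg _) (norm_inner_le_norm _ _) 2
      nlinarith [mul_le_mul_of_nonneg_left h1 (sq_nonneg k)]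
  refine hbd.trans (le_of_eq ?_)
  rw [intervalIntegral.integral_const_mul, intervalIntegral.integral_add
    (intervalIntegrable_norm_sq g) ((intervalIntegrable_norm_sq _).const_mul _),
    intervalIntegral.integral_const_mul, integral_norm_sq_eq, integral_norm_sq_eq]

/-- A crude version of the pointwise bound, valid for every value of the flux. -/
theorem norm_sq_cauchySolution_le (w : FormDomain M ha) {x k : ℝ}
    (hx : x ∈ Ioo 0 (2 * Real.pi)) (hk : 1 ≤ k) :
    k * ‖cauchySolution a w.1 x‖ ^ 2 ≤
      ‖w.1.snd‖ ^ 2 + k ^ 2 * ‖formEmbedding M ha w‖ ^ 2 := by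
  set U := cauchySolution a w.1 x
  -- With `b = U`, one factor `‖U‖²` cancels at the end.
  have h := pointwise_energy_bound w U hx (by linarith : 0 < k)
  rw [inner_self_eq_norm_sq_to_K] at h
  have hn : ‖((‖U‖ : ℂ)) ^ 2‖ = ‖U‖ ^ 2 := by simp
  set X := ‖w.1.snd‖ ^ 2 + k ^ 2 * ‖formEmbedding M ha w‖ ^ 2 with hX
  have hX0 : 0 ≤ X := by positivity
  set t := k * (2 * Real.pi)
  -- This makes `cosh t ≥ 2`, so `2 (cosh t - cos) ≥ cosh t ≥ sinh t` even for integral flux.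
  have ht : 6 ≤ t := by
    have := Real.pi_gt_three
    have : 1 * 6 ≤ k * (2 * Real.pi) := mul_le_mul hk (by linarith) (by norm_num) (by linarith)
    linarith
  have hcosh : 2 ≤ Real.cosh t := by
    rw [Real.cosh_eq]
    linarith [Real.add_one_le_exp t, Real.exp_pos (-t)]
  have hsinh := (Real.sinh_lt_cosh t).le
  have hcos := Real.cos_le_one (2 * Real.pi * flux a)
  rcases eq_or_ne ‖U‖ 0 with h0 | h0
  · rw [h0]; simpa using hX0
  have hU : 0 < ‖U‖ ^ 2 := by positivity
  replace h : 2 * k * (Real.cosh t - Real.cos (2 * Real.pi * flux a)) * (‖U‖ ^ 2) ^ 2 ≤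
      Real.sinh t * (‖U‖ ^ 2 * X) := by
    rw [← hn]; simpa using h
  have h1 : Real.cosh t * (k * ‖U‖ ^ 2) * ‖U‖ ^ 2 ≤ Real.cosh t * X * ‖U‖ ^ 2 := by
    have h2 : Real.sinh t * (‖U‖ ^ 2 * X) ≤ Real.cosh t * (‖U‖ ^ 2 * X) :=
      mul_le_mul_of_nonneg_right hsinh (by positivity)
    have h3 : Real.cosh t * (k * (‖U‖ ^ 2) ^ 2) ≤
        (2 * (Real.cosh t - Real.cos (2 * Real.pi * flux a))) * (k * (‖U‖ ^ 2) ^ 2) :=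
      mul_le_mul_of_nonneg_right (by linarith) (by positivity)
    linarith
  have h4 := le_of_mul_le_mul_right h1 hU
  exact le_of_mul_le_mul_left h4 (by linarith)

/-- The value at the interior point `π` is bounded by the case `k = 1` and carried to `0` by the
Hölder estimate. As `2π < 7`, the coefficient of the derivative term is `2 + 2·7 = 16`. -/
theorem norm_sq_fst_le (w : FormDomain M ha) :
    ‖w.1.fst‖ ^ 2 ≤ 16 * ‖w.1.snd‖ ^ 2 + 2 * ‖formEmbedding M ha w‖ ^ 2 := by
  have hpi : Real.pi ∈ Ioo 0 (2 * Real.pi) := ⟨Real.pi_pos, by linarith [Real.pi_pos]⟩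
  have h1 := norm_sq_cauchySolution_le w hpi le_rfl
  have h2 := norm_gauged_le ha w.1.fst w.1.snd (Ioo_subset_Icc_self hpi) zero_mem_circle
  rw [gauged_zero] at h2
  rw [cauchySolution, norm_smul, norm_phase] at h1
  have h3 : (‖w.1.snd‖ * Real.sqrt (2 * Real.pi)) ^ 2 ≤ 7 * ‖w.1.snd‖ ^ 2 := by
    rw [mul_pow, Real.sq_sqrt two_pi_nonneg]
    nlinarith [Real.pi_lt_d2, sq_nonneg ‖w.1.snd‖]
  have h4 := pow_le_pow_left₀ (norm_nonneg _) h2 2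
  nlinarith [sq_nonneg (‖gauged a w.1.fst w.1.snd Real.pi‖ - ‖w.1.snd‖ * Real.sqrt (2 * Real.pi))]

end

section

variable {M : ℕ} {a : ℝ → ℝ}

/-! ### Spectral decomposition of the potential -/

theorem inner_toEuclideanLin_eq_sum {A : Matrix (Fin M) (Fin M) ℂ} (hA : A.IsHermitian)
    (v u : EuclideanSpace ℂ (Fin M)) :
    inner ℂ v (Matrix.toEuclideanLin A u) = ∑ k, (hA.eigenvalues k : ℂ) *
      (inner ℂ v (hA.eigenvectorBasis k) * inner ℂ (hA.eigenvectorBasis k) u) := by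
  have h1 : ∀ k, Matrix.toEuclideanLin A (hA.eigenvectorBasis k) =
      (hA.eigenvalues k : ℂ) • hA.eigenvectorBasis k := by
    intro k
    rw [Matrix.toLpLin_apply, hA.mulVec_eigenvectorBasis]
    rfl
  conv_lhs => rw [← hA.eigenvectorBasis.sum_repr' u]
  rw [map_sum, inner_sum]
  refine Finset.sum_congr rfl fun k _ => ?_
  rw [map_smul, h1, inner_smul_right, inner_smul_right]
  ring

theorem tracePowThreeHalves_eq_sum {A : Matrix (Fin M) (Fin M) ℂ} (hA : A.IsHermitian) :
    tracePowThreeHalves A = ∑ k, hA.eigenvalues k ^ (3 / 2 : ℝ) := by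
  rw [tracePowThreeHalves, hA.cfc_eq, Matrix.IsHermitian.cfc, Unitary.conjStarAlgAut_apply,
    Matrix.trace_mul_comm, ← mul_assoc, Unitary.coe_star_mul_self, one_mul, Matrix.trace_diagonal]
  simp

/-- Each eigenvalue satisfies `λ ≤ 1 + λ^(3/2)`; summing produces a majorant that is integrable for
an admissible potential. -/
theorem norm_inner_toEuclideanLin_le {A : Matrix (Fin M) (Fin M) ℂ} (hA : A.PosSemidef)
    (v u : EuclideanSpace ℂ (Fin M)) :
    ‖inner ℂ v (Matrix.toEuclideanLin A u)‖ ≤ (M + tracePowThreeHalves A) * (‖v‖ * ‖u‖) := by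
  rw [inner_toEuclideanLin_eq_sum hA.1, tracePowThreeHalves_eq_sum hA.1]
  refine (norm_sum_le _ _).trans ?_
  have h1 : (M : ℝ) + ∑ k, hA.1.eigenvalues k ^ (3 / 2 : ℝ) =
      ∑ k, (1 + hA.1.eigenvalues k ^ (3 / 2 : ℝ)) := by
    rw [Finset.sum_add_distrib]; simp
  rw [h1, Finset.sum_mul]
  refine Finset.sum_le_sum fun k _ => ?_
  have hk := hA.eigenvalues_nonneg k
  rw [norm_mul, norm_mul, Complex.norm_real, Real.norm_of_nonneg hk]
  have hb : ‖hA.1.eigenvectorBasis k‖ = 1 := hA.1.eigenvectorBasis.orthonormal.1 k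
  have h2 : ‖inner ℂ v (hA.1.eigenvectorBasis k)‖ ≤ ‖v‖ := by
    simpa [hb] using norm_inner_le_norm (𝕜 := ℂ) v (hA.1.eigenvectorBasis k)
  have h3 : ‖inner ℂ (hA.1.eigenvectorBasis k) u‖ ≤ ‖u‖ := by
    simpa [hb] using norm_inner_le_norm (𝕜 := ℂ) (hA.1.eigenvectorBasis k) u
  have h4 : hA.1.eigenvalues k ≤ 1 + hA.1.eigenvalues k ^ (3 / 2 : ℝ) := by
    rcases le_total (hA.1.eigenvalues k) 1 with h | h
    · linarith [Real.rpow_nonneg hk (3 / 2 : ℝ)]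
    · have := Real.rpow_le_rpow_of_exponent_le h (by norm_num : (1 : ℝ) ≤ 3 / 2)
      rw [Real.rpow_one] at this
      linarith
  exact mul_le_mul h4 (mul_le_mul h2 h3 (norm_nonneg _) (norm_nonneg _)) (by positivity)
    (by positivity)

theorem potentialPairing_conj {V : ℝ → Matrix (Fin M) (Fin M) ℂ} {x : ℝ} (hV : (V x).IsHermitian)
    (v u : L2Circle M) :
    starRingEnd ℂ (potentialPairing V u v x) = potentialPairing V v u x := by
  rw [potentialPairing, potentialPairing, inner_toEuclideanLin_eq_sum hV,
    inner_toEuclideanLin_eq_sum hV, map_sum]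
  refine Finset.sum_congr rfl fun k _ => ?_
  simp only [map_mul, Complex.conj_ofReal, inner_conj_symm]
  ring

theorem potentialPairing_add_left (V : ℝ → Matrix (Fin M) (Fin M) ℂ) (v v' u : L2Circle M) :
    potentialPairing V (v + v') u =ᵐ[circleMeasure]
      potentialPairing V v u + potentialPairing V v' u := by
  filter_upwards [Lp.coeFn_add v v'] with x hx
  simp only [potentialPairing, hx, Pi.add_apply, inner_add_left]

theorem potentialPairing_smul_left (V : ℝ → Matrix (Fin M) (Fin M) ℂ) (c : ℂ) (v u : L2Circle M) :
    potentialPairing V (c • v) u =ᵐ[circleMeasure] starRingEnd ℂ c • potentialPairing V v u := by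
  filter_upwards [Lp.coeFn_smul c v] with x hx
  simp only [potentialPairing, hx, Pi.smul_apply, inner_smul_left, smul_eq_mul]

/-! ### Admissible potentials and the Schrödinger form -/

/-- Admissible potentials. -/
structure IsAdmissible (V : ℝ → Matrix (Fin M) (Fin M) ℂ) : Prop where
  aestronglyMeasurable : AEStronglyMeasurable V circleMeasure
  posSemidef : ∀ᵐ x ∂circleMeasure, (V x).PosSemidef
  integrable : Integrable (fun x => tracePowThreeHalves (V x)) circleMeasure

variable {V : ℝ → Matrix (Fin M) (Fin M) ℂ}

theorem potentialPairing_aestronglyMeasurable (hV : IsAdmissible V) (v u : L2Circle M) :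
    AEStronglyMeasurable (potentialPairing V v u) circleMeasure := by
  have hc : Continuous fun p : Matrix (Fin M) (Fin M) ℂ ×
      (EuclideanSpace ℂ (Fin M) × EuclideanSpace ℂ (Fin M)) =>
      (inner ℂ p.2.1 (Matrix.toEuclideanLin p.1 p.2.2) : ℂ) := by
    simp only [Matrix.toLpLin_apply]
    fun_prop
  have hf : AEStronglyMeasurable (fun x => (V x, (v x, u x))) circleMeasure :=
    hV.aestronglyMeasurable.prodMk
      ((Lp.memLp v).aestronglyMeasurable.prodMk (Lp.memLp u).aestronglyMeasurable)
  have h1 : potentialPairing V v u =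
      fun x => inner ℂ (v x) (Matrix.toEuclideanLin (V x) (u x)) := by
    funext x
    rw [potentialPairing]
  have h2 := hc.comp_aestronglyMeasurable hf
  rw [h1]
  exact h2

/-- An integrable majorant of the norm of the potential. -/
def potentialBound (V : ℝ → Matrix (Fin M) (Fin M) ℂ) (x : ℝ) : ℝ := M + tracePowThreeHalves (V x)

theorem potentialBound_integrable (hV : IsAdmissible V) :
    Integrable (potentialBound V) circleMeasure :=
  (integrable_const _).add hV.integrable

theorem potentialBound_nonneg {x : ℝ} (hx : (V x).PosSemidef) : 0 ≤ potentialBound V x := by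
  rw [potentialBound, tracePowThreeHalves_eq_sum hx.1]
  have := Finset.sum_nonneg fun k (_ : k ∈ Finset.univ) =>
    Real.rpow_nonneg (hx.eigenvalues_nonneg k) (3 / 2 : ℝ)
  positivity

theorem integral_potentialBound_nonneg (hV : IsAdmissible V) :
    0 ≤ ∫ x, potentialBound V x ∂circleMeasure :=
  integral_nonneg_of_ae (hV.posSemidef.mono fun _ hx => potentialBound_nonneg hx)

variable {ha : IntegrableOn a (Ioc 0 (2 * Real.pi))}

theorem norm_formEmbedding_le_ae (w : FormDomain M ha) :
    ∀ᵐ x ∂circleMeasure, ‖formEmbedding M ha w x‖ ≤ ‖gaugedCLM (M := M) ha‖ * ‖w‖ := by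
  filter_upwards [formEmbedding_ae w, ae_restrict_mem measurableSet_Ioc] with x hx hx'
  rw [hx, cauchySolution, norm_smul, norm_phase, one_mul]
  exact ((gaugedCLM ha w.1).norm_coe_le_norm ⟨x, Ioc_subset_Icc_self hx'⟩).trans
    ((gaugedCLM ha).le_opNorm w.1)

theorem norm_potentialPairing_le_ae (hV : IsAdmissible V) {v u : L2Circle M} {r s : ℝ}
    (hr : ∀ᵐ x ∂circleMeasure, ‖v x‖ ≤ r) (hs : ∀ᵐ x ∂circleMeasure, ‖u x‖ ≤ s) :
    ∀ᵐ x ∂circleMeasure, ‖potentialPairing V v u x‖ ≤ potentialBound V x * (r * s) := by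
  filter_upwards [hV.posSemidef, hr, hs] with x h1 h2 h3
  refine (norm_inner_toEuclideanLin_le h1 _ _).trans ?_
  exact mul_le_mul_of_nonneg_left (mul_le_mul h2 h3 (norm_nonneg _) ((norm_nonneg _).trans h2))
    (potentialBound_nonneg h1)

theorem potentialPairing_integrable (hV : IsAdmissible V) (v w : FormDomain M ha) :
    Integrable (potentialPairing V (formEmbedding M ha v) (formEmbedding M ha w)) circleMeasure :=
  ((potentialBound_integrable hV).mul_const _).mono'
    (potentialPairing_aestronglyMeasurable hV _ _)
    (norm_potentialPairing_le_ae hV (norm_formEmbedding_le_ae v) (norm_formEmbedding_le_ae w))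

theorem norm_integral_potentialPairing_le (hV : IsAdmissible V) {v u : L2Circle M} {r s : ℝ}
    (hr : ∀ᵐ x ∂circleMeasure, ‖v x‖ ≤ r) (hs : ∀ᵐ x ∂circleMeasure, ‖u x‖ ≤ s) :
    ‖∫ x, potentialPairing V v u x ∂circleMeasure‖ ≤
      (∫ x, potentialBound V x ∂circleMeasure) * (r * s) := by
  rw [← integral_mul_const]
  exact norm_integral_le_of_norm_le ((potentialBound_integrable hV).mul_const _)
    (norm_potentialPairing_le_ae hV hr hs)

/-- The quadratic form of the magnetic Schrödinger operator. -/
def schrodingerForm (ha : IntegrableOn a (Ioc 0 (2 * Real.pi))) (hV : IsAdmissible V) :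
    FormDomain M ha →L⋆[ℂ] FormDomain M ha →L[ℂ] ℂ :=
  LinearMap.mkContinuous₂
    (LinearMap.mk₂'ₛₗ (starRingEnd ℂ) (RingHom.id ℂ)
      (fun v w => inner ℂ v.1.snd w.1.snd -
        ∫ x, potentialPairing V (formEmbedding M ha v) (formEmbedding M ha w) x ∂circleMeasure)
      (fun v v' w => by
        rw [map_add, integral_congr_ae (potentialPairing_add_left V _ _ _)]
        simp only [Pi.add_apply]
        rw [integral_add (potentialPairing_integrable hV v w)
          (potentialPairing_integrable hV v' w)]
        change inner ℂ (v.1.snd + v'.1.snd) _ - _ = _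
        rw [inner_add_left]
        ring)
      (fun c v w => by
        rw [map_smul, integral_congr_ae (potentialPairing_smul_left V _ _ _)]
        simp only [Pi.smul_apply]
        rw [integral_smul]
        change inner ℂ (c • v.1.snd) _ - _ = _
        rw [inner_smul_left, smul_eq_mul, smul_eq_mul]
        ring)
      (fun v w w' => by
        rw [map_add, integral_congr_ae (potentialPairing_add V _ _ _)]
        simp only [Pi.add_apply]
        rw [integral_add (potentialPairing_integrable hV v w)
          (potentialPairing_integrable hV v w')]
        change inner ℂ _ (w.1.snd + w'.1.snd) - _ = _
        rw [inner_add_right]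
        ring)
      (fun c v w => by
        rw [map_smul, integral_congr_ae (potentialPairing_smul V _ _ _)]
        simp only [Pi.smul_apply]
        rw [integral_smul]
        change inner ℂ _ (c • w.1.snd) - _ = _
        rw [inner_smul_right, smul_eq_mul, RingHom.id_apply, smul_eq_mul]
        ring))
    (1 + (∫ x, potentialBound V x ∂circleMeasure) * ‖gaugedCLM (M := M) ha‖ ^ 2)
    fun v w => by
      refine (norm_sub_le _ _).trans ?_
      have h1 : ‖(inner ℂ v.1.snd w.1.snd : ℂ)‖ ≤ ‖v‖ * ‖w‖ :=
        (norm_inner_le_norm _ _).trans (mul_le_mul (WithLp.norm_snd_le (x := v.1) ..)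
          (WithLp.norm_snd_le (x := w.1) ..) (norm_nonneg _) (norm_nonneg _))
      have h2 := norm_integral_potentialPairing_le hV (norm_formEmbedding_le_ae v)
        (norm_formEmbedding_le_ae w)
      linarith

theorem schrodingerForm_apply (hV : IsAdmissible V) (v w : FormDomain M ha) :
    schrodingerForm ha hV v w = inner ℂ v.1.snd w.1.snd -
      ∫ x, potentialPairing V (formEmbedding M ha v) (formEmbedding M ha w) x ∂circleMeasure := rfl

theorem schrodingerForm_conj (hV : IsAdmissible V) (v w : FormDomain M ha) :
    schrodingerForm ha hV v w = starRingEnd ℂ (schrodingerForm ha hV w v) := by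
  rw [schrodingerForm_apply, schrodingerForm_apply, map_sub, inner_conj_symm, ← integral_conj]
  congr 1
  refine integral_congr_ae ?_
  filter_upwards [hV.posSemidef] with x hx
  exact (potentialPairing_conj hx.1 _ _).symm

theorem schrodingerForm_coercive (hV : IsAdmissible V) :
    ∃ μ : ℝ, ∀ w : FormDomain M ha, (1 / 40 : ℝ) * ‖w‖ ^ 2 ≤
      (schrodingerForm ha hV w w).re + μ * ‖formEmbedding M ha w‖ ^ 2 := by
  set T := ∫ x, potentialBound V x ∂circleMeasure with hT
  have hT0 : 0 ≤ T := integral_potentialBound_nonneg hV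
  -- Chosen so that `T / k ≤ 1/2`: the potential then costs at most half of `‖g‖²` plus `k T ‖u‖²`.
  set k : ℝ := 1 + 2 * T
  have hk : 1 ≤ k := by simp only [k]; linarith
  have hk0 : 0 < k := by linarith
  -- This shift leaves `‖g‖²/2 + ‖u‖²`, while `‖w‖² ≤ 17 ‖g‖² + 2 ‖u‖²`; the factor `1/40` is small
  -- enough for both terms.
  refine ⟨k * T + 1, fun w => ?_⟩
  set u := formEmbedding M ha w
  set g := w.1.snd
  set N := (‖g‖ ^ 2 + k ^ 2 * ‖u‖ ^ 2) / k with hN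
  have hbd : ∀ᵐ x ∂circleMeasure, ‖u x‖ ≤ Real.sqrt N := by
    have h3 : ∀ᵐ x ∂circleMeasure, x ∈ Ioo 0 (2 * Real.pi) := by
      rw [circleMeasure, ← restrict_Ioo_eq_restrict_Ioc]
      exact ae_restrict_mem measurableSet_Ioo
    filter_upwards [formEmbedding_ae w, h3] with x hx hx'
    refine Real.le_sqrt_of_sq_le ?_
    rw [hx, hN, le_div_iff₀ hk0, mul_comm]
    exact norm_sq_cauchySolution_le w hx' hk
  have h1 := norm_integral_potentialPairing_le hV hbd hbd
  rw [Real.mul_self_sqrt (by positivity), ← hT] at h1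
  have h2 : (schrodingerForm ha hV w w).re = ‖g‖ ^ 2 -
      (∫ x, potentialPairing V u u x ∂circleMeasure).re := by
    rw [schrodingerForm_apply, Complex.sub_re, inner_self_eq_norm_sq_to_K]
    simp [← Complex.ofReal_pow, g, u]
  have h3 := (Complex.re_le_norm _).trans h1
  have h4 : T * N ≤ (1 / 2) * ‖g‖ ^ 2 + k * T * ‖u‖ ^ 2 := by
    rw [hN, mul_div_assoc', div_le_iff₀ hk0]
    have : T ≤ 1 / 2 * k := by simp only [k]; linarith
    nlinarith [mul_le_mul_of_nonneg_right this (sq_nonneg ‖g‖)]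
  have h5 : ‖w‖ ^ 2 = ‖w.1.fst‖ ^ 2 + ‖g‖ ^ 2 := WithLp.prod_norm_sq_eq_of_L2 w.1
  have h6 := norm_sq_fst_le w
  rw [h2, h5]
  change ‖w.1.fst‖ ^ 2 ≤ 16 * ‖g‖ ^ 2 + 2 * ‖u‖ ^ 2 at h6
  nlinarith [sq_nonneg ‖g‖, sq_nonneg ‖u‖]

/-- Puts the operator into the shape required by `hasDiscreteSpectrum_of_form`. -/
theorem schrodingerOperator_iff (ha : IntegrableOn a (Ioc 0 (2 * Real.pi))) (hV : IsAdmissible V)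
    (u f : L2Circle M) :
    (∃ hu : u ∈ (schrodingerOperator a V).domain, schrodingerOperator a V ⟨u, hu⟩ = f) ↔
      ∃ w : FormDomain M ha, formEmbedding M ha w = u ∧
        ∀ v, schrodingerForm ha hV v w = inner ℂ (formEmbedding M ha v) f := by
  have h1 : (∃ hu : u ∈ (schrodingerOperator a V).domain, schrodingerOperator a V ⟨u, hu⟩ = f) ↔
      (u, f) ∈ (schrodingerOperator a V).graph := by
    rw [LinearPMap.mem_graph_iff]
    constructor
    · rintro ⟨hu, h⟩
      exact ⟨⟨u, hu⟩, rfl, h⟩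
    · rintro ⟨⟨y, hy⟩, rfl, h⟩
      exact ⟨hy, h⟩
  rw [h1, schrodingerOperator_graph ha]
  constructor
  · rintro ⟨hu, h⟩
    obtain ⟨w, rfl⟩ := exists_formEmbedding_eq (ha := ha) hu
    refine ⟨w, rfl, fun v => ?_⟩
    have h2 := (h ⟨_, formEmbedding_mem_domain v⟩).2
    rw [magneticDeriv_formEmbedding v, magneticDeriv_formEmbedding w] at h2
    exact h2
  · rintro ⟨w, rfl, h⟩
    refine ⟨formEmbedding_mem_domain w, ?_⟩
    rintro ⟨y, hy⟩
    obtain ⟨v, rfl⟩ := exists_formEmbedding_eq (ha := ha) hy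
    refine ⟨potentialPairing_integrable hV v w, ?_⟩
    rw [magneticDeriv_formEmbedding v, magneticDeriv_formEmbedding w]
    exact h v

theorem hasDiscreteSpectrum_schrodingerOperator (ha : IntegrableOn a (Ioc 0 (2 * Real.pi)))
    (hV : IsAdmissible V) : HasDiscreteSpectrum (schrodingerOperator a V) := by
  obtain ⟨μ, hμ⟩ := schrodingerForm_coercive (ha := ha) hV
  have hc : (0 : ℝ) < 1 / 40 := by norm_num
  have h1 := hasDiscreteSpectrum_of_form (W := FormDomain M ha) (T := schrodingerOperator a V)
    (J := formEmbedding M ha)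
  have h2 := h1 isCompactOperator_formEmbedding (h := schrodingerForm ha hV)
    (schrodingerForm_conj hV) (μ := μ) (c := 1 / 40) hc
  have h3 := h2 hμ
  exact h3 (schrodingerOperator_iff ha hV)

end

section

variable {M : ℕ} {a : ℝ → ℝ} {V : ℝ → Matrix (Fin M) (Fin M) ℂ}
  {ha : IntegrableOn a (Ioc 0 (2 * Real.pi))}

/-! ### The Lieb–Thirring inequality for finite orthonormal families -/

/-- Young's inequality, the source of `2/(3√3)`. With `v = 3t²` and `ρ = K r` it becomes `3t²r ≤ r³
+ 2t³`, that is `(r - t)² (r + 2t) ≥ 0`. -/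
theorem mul_le_cube_add_rpow {K v ρ : ℝ} (hK : 0 < K) (hv : 0 ≤ v) (hρ : 0 ≤ ρ) :
    v * ρ ≤ ρ ^ 3 / K ^ 2 + 2 / (3 * Real.sqrt 3) * K * v ^ (3 / 2 : ℝ) := by
  have h3 : 0 < Real.sqrt 3 := by positivity
  have h33 : Real.sqrt 3 ^ 2 = 3 := Real.sq_sqrt (by norm_num)
  obtain ⟨t, ht0, ht⟩ : ∃ t : ℝ, 0 ≤ t ∧ Real.sqrt v = Real.sqrt 3 * t :=
    ⟨Real.sqrt v / Real.sqrt 3, by positivity, by field_simp⟩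
  obtain ⟨r, hr0, hr⟩ : ∃ r : ℝ, 0 ≤ r ∧ ρ = K * r := ⟨ρ / K, by positivity, by field_simp⟩
  have hv2 : v = 3 * t ^ 2 := by
    rw [← h33, ← mul_pow, ← ht, Real.sq_sqrt hv]
  have hpow : v ^ (3 / 2 : ℝ) = 3 * Real.sqrt 3 * t ^ 3 := by
    have h1 : v ^ (3 / 2 : ℝ) = Real.sqrt v ^ 3 := by
      rw [Real.sqrt_eq_rpow, ← Real.rpow_natCast, ← Real.rpow_mul hv]
      norm_num
    rw [h1, ht]
    linear_combination Real.sqrt 3 * t ^ 3 * h33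
  have h4 : ρ ^ 3 / K ^ 2 + 2 / (3 * Real.sqrt 3) * K * v ^ (3 / 2 : ℝ) =
      K * (r ^ 3 + 2 * t ^ 3) := by
    rw [hpow, hr]
    field_simp
  rw [h4, hv2, hr]
  have h5 : 3 * t ^ 2 * r ≤ r ^ 3 + 2 * t ^ 3 := by
    nlinarith [mul_nonneg (sq_nonneg (r - t)) (by linarith : 0 ≤ r + 2 * t)]
  nlinarith [mul_le_mul_of_nonneg_left h5 hK.le]

theorem FormDomain.snd_sum {ι : Type*} (s : Finset ι) (c : ι → ℂ) (w : ι → FormDomain M ha) :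
    (∑ i ∈ s, c i • w i).1.snd = ∑ i ∈ s, c i • (w i).1.snd := by
  have h := map_sum ((WithLp.sndL 2 ℂ (EuclideanSpace ℂ (Fin M)) (L2Circle M)) ∘L
    (monodromyDefect (M := M) ha).ker.subtypeL) (fun i => c i • w i) s
  simp only [map_smul] at h
  exact h

theorem cauchySolution_sum {ι : Type*} (s : Finset ι) (c : ι → ℂ) (w : ι → FormDomain M ha) {x : ℝ}
    (hx : x ∈ Icc 0 (2 * Real.pi)) :
    cauchySolution a (∑ i ∈ s, c i • w i).1 x = ∑ i ∈ s, c i • cauchySolution a (w i).1 x := by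
  have h := map_sum ((phase a x • ContinuousMap.evalCLM ℂ (⟨x, hx⟩ : Icc (0 : ℝ) (2 * Real.pi))) ∘L
    (gaugedCLM (M := M) ha) ∘L (monodromyDefect (M := M) ha).ker.subtypeL)
    (fun i => c i • w i) s
  simp only [map_smul] at h
  exact h

/-- The cube of the density of an orthonormal family in a fixed direction is bounded by the
corresponding kinetic energy density. -/
theorem density_cube_le {ι : Type*} [Fintype ι] {w : ι → FormDomain M ha}
    (hw : Orthonormal ℂ fun i => formEmbedding M ha (w i)) (hα : ∀ n : ℤ, flux a ≠ n)
    (b : EuclideanSpace ℂ (Fin M)) (hb : ‖b‖ = 1) {x : ℝ} (hx : x ∈ Ioo 0 (2 * Real.pi)) :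
    (∑ i, ‖inner ℂ (cauchySolution a (w i).1 x) b‖ ^ 2) ^ 3 / magneticConst (flux a) ^ 2 ≤
      ‖∑ i, inner ℂ (cauchySolution a (w i).1 x) b • (w i).1.snd‖ ^ 2 := by
  set c : ι → ℂ := fun i => inner ℂ (cauchySolution a (w i).1 x) b with hc
  set ρ : ℝ := ∑ i, ‖c i‖ ^ 2 with hρ
  set K := magneticConst (flux a)
  have hK : 0 < K := magneticConst_pos hα
  have hρ0 : 0 ≤ ρ := Finset.sum_nonneg fun i _ => sq_nonneg _
  set τ := ‖∑ i, c i • (w i).1.snd‖ ^ 2 with hτ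
  have hτ0 : 0 ≤ τ := sq_nonneg _
  rcases hρ0.eq_or_lt with h0 | hpos
  · rw [← h0]; simpa using hτ0
  -- For this combination both the squared `L²` norm and the component along `b` at `x` equal `ρ`.
  -- The choice `k = ρ/K` maximizes `2kρ² - K k² ρ`.
  have h1 := pointwise_energy_bound (∑ i, c i • w i) b hx (div_pos hpos hK)
  rw [FormDomain.snd_sum, cauchySolution_sum _ _ _ (Ioo_subset_Icc_self hx), hb, one_pow,
    one_mul, ← hτ] at h1
  have h2 : ‖formEmbedding M ha (∑ i, c i • w i)‖ ^ 2 = ρ := by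
    have h3 : inner ℂ (formEmbedding M ha (∑ i, c i • w i))
        (formEmbedding M ha (∑ i, c i • w i)) = (ρ : ℂ) := by
      rw [map_sum]
      simp only [map_smul]
      rw [hw.inner_sum, hρ]
      push_cast
      exact Finset.sum_congr rfl fun i _ => Complex.conj_mul' _
    rw [inner_self_eq_norm_sq_to_K] at h3
    refine Complex.ofReal_injective ?_
    rw [Complex.ofReal_pow]
    exact h3
  have h4 : inner ℂ b (∑ i, c i • cauchySolution a (w i).1 x) = (ρ : ℂ) := by
    rw [inner_sum, hρ]
    push_cast
    refine Finset.sum_congr rfl fun i _ => ?_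
    rw [inner_smul_right, ← inner_conj_symm b]
    exact Complex.mul_conj' _
  rw [h2, h4, Complex.norm_real, Real.norm_of_nonneg hρ0] at h1
  set t := ρ / K * (2 * Real.pi)
  have hD : 0 < Real.cosh t - Real.cos (2 * Real.pi * flux a) := by
    have ht : t ≠ 0 := (mul_pos (div_pos hpos hK) (by positivity)).ne'
    linarith [Real.one_lt_cosh.2 ht, Real.cos_le_one (2 * Real.pi * flux a)]
  have h5 := mul_le_mul_of_nonneg_right (sinh_le_magneticConst_mul hα t)
    (by positivity : 0 ≤ τ + (ρ / K) ^ 2 * ρ)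
  have h6 : (Real.cosh t - Real.cos (2 * Real.pi * flux a)) * (2 * (ρ / K) * ρ ^ 2) ≤
      (Real.cosh t - Real.cos (2 * Real.pi * flux a)) * (K * (τ + (ρ / K) ^ 2 * ρ)) := by
    linarith
  have h7 := le_of_mul_le_mul_left h6 hD
  have h8 : K * (ρ ^ 3 / K ^ 2) ≤ K * τ := by
    have e1 : 2 * (ρ / K) * ρ ^ 2 = 2 * (K * (ρ ^ 3 / K ^ 2)) := by field_simp
    have e2 : K * (τ + (ρ / K) ^ 2 * ρ) = K * τ + K * (ρ ^ 3 / K ^ 2) := by field_simp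
    linarith
  exact le_of_mul_le_mul_left h8 hK

/-- The pointwise form of the Lieb–Thirring inequality. -/
theorem sum_potential_le {ι : Type*} [Fintype ι] {w : ι → FormDomain M ha}
    (hw : Orthonormal ℂ fun i => formEmbedding M ha (w i)) (hα : ∀ n : ℤ, flux a ≠ n)
    {A : Matrix (Fin M) (Fin M) ℂ} (hA : A.PosSemidef) {x : ℝ} (hx : x ∈ Ioo 0 (2 * Real.pi)) :
    (∑ i, inner ℂ (cauchySolution a (w i).1 x)
      (Matrix.toEuclideanLin A (cauchySolution a (w i).1 x))).re ≤
    (∑ i, ∑ j, inner ℂ (cauchySolution a (w j).1 x) (cauchySolution a (w i).1 x) *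
      inner ℂ (w i).1.snd (w j).1.snd).re +
      2 / (3 * Real.sqrt 3) * magneticConst (flux a) * tracePowThreeHalves A := by
  set f : ι → EuclideanSpace ℂ (Fin M) := fun i => cauchySolution a (w i).1 x
  set B := hA.1.eigenvectorBasis
  set K := magneticConst (flux a)
  have hK : 0 < K := magneticConst_pos hα
  have h1 : (∑ i, inner ℂ (f i) (Matrix.toEuclideanLin A (f i))).re =
      ∑ k, hA.1.eigenvalues k * ∑ i, ‖inner ℂ (f i) (B k)‖ ^ 2 := by
    have : (∑ i, inner ℂ (f i) (Matrix.toEuclideanLin A (f i))) =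
        ((∑ k, hA.1.eigenvalues k * ∑ i, ‖inner ℂ (f i) (B k)‖ ^ 2 : ℝ) : ℂ) := by
      simp_rw [inner_toEuclideanLin_eq_sum hA.1]
      rw [Finset.sum_comm]
      push_cast
      refine Finset.sum_congr rfl fun k _ => ?_
      rw [Finset.mul_sum]
      refine Finset.sum_congr rfl fun i _ => ?_
      rw [← inner_conj_symm (B k), ← Complex.mul_conj']
    rw [this, Complex.ofReal_re]
  -- Parseval makes the sum over the eigenbasis basis-free, so no measurable choice of eigenvectors
  -- of `V x` is needed when integrating in `x`.
  have h2 : (∑ i, ∑ j, inner ℂ (f j) (f i) * inner ℂ (w i).1.snd (w j).1.snd).re =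
      ∑ k, ‖∑ i, inner ℂ (f i) (B k) • (w i).1.snd‖ ^ 2 := by
    have : (∑ i, ∑ j, inner ℂ (f j) (f i) * inner ℂ (w i).1.snd (w j).1.snd) =
        ((∑ k, ‖∑ i, inner ℂ (f i) (B k) • (w i).1.snd‖ ^ 2 : ℝ) : ℂ) := by
      push_cast
      have e1 : ∀ k, ((‖∑ i, inner ℂ (f i) (B k) • (w i).1.snd‖ : ℝ) : ℂ) ^ 2 =
          ∑ i, ∑ j, (inner ℂ (f j) (B k) * inner ℂ (B k) (f i)) *
            inner ℂ (w i).1.snd (w j).1.snd := by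
        intro k
        have e2 := inner_self_eq_norm_sq_to_K (𝕜 := ℂ) (∑ i, inner ℂ (f i) (B k) • (w i).1.snd)
        refine Eq.trans e2.symm ?_
        rw [sum_inner (𝕜 := ℂ)]
        refine Finset.sum_congr rfl fun i _ => ?_
        rw [inner_sum]
        refine Finset.sum_congr rfl fun j _ => ?_
        rw [inner_smul_left, inner_smul_right, inner_conj_symm]
        ring
      simp_rw [e1]
      symm
      rw [Finset.sum_comm]
      refine Finset.sum_congr rfl fun i _ => ?_
      rw [Finset.sum_comm]
      refine Finset.sum_congr rfl fun j _ => ?_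
      rw [← Finset.sum_mul, B.sum_inner_mul_inner]
    rw [this, Complex.ofReal_re]
  rw [h1, h2, tracePowThreeHalves_eq_sum hA.1, Finset.mul_sum, ← Finset.sum_add_distrib]
  refine Finset.sum_le_sum fun k _ => ?_
  refine (mul_le_cube_add_rpow hK (hA.eigenvalues_nonneg k)
    (Finset.sum_nonneg fun i _ => sq_nonneg _)).trans ?_
  exact add_le_add (density_cube_le hw hα (B k) (B.orthonormal.1 k) hx) le_rfl

/-- Integrates `sum_potential_le` over the circle. Orthonormality leaves only the diagonal of the
double sum, which cancels the kinetic energy in the form exactly. -/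
theorem neg_sum_form_le {ι : Type*} [Fintype ι] {w : ι → FormDomain M ha}
    (hw : Orthonormal ℂ fun i => formEmbedding M ha (w i)) (hα : ∀ n : ℤ, flux a ≠ n)
    (hV : IsAdmissible V) :
    -∑ i, (schrodingerForm ha hV (w i) (w i)).re ≤
      2 / (3 * Real.sqrt 3) * magneticConst (flux a) *
        ∫ x, tracePowThreeHalves (V x) ∂circleMeasure := by
  classical
  set φ : ι → L2Circle M := fun i => formEmbedding M ha (w i) with hφ
  have hΘi : ∀ i j, Integrable (fun x => inner ℂ (φ j x) (φ i x) *
      inner ℂ (w i).1.snd (w j).1.snd) circleMeasure := fun i j =>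
    (L2.integrable_inner (φ j) (φ i)).mul_const _
  have hΘ : Integrable (fun x => ∑ i, ∑ j, inner ℂ (φ j x) (φ i x) *
      inner ℂ (w i).1.snd (w j).1.snd) circleMeasure :=
    integrable_finsetSum _ fun i _ => integrable_finsetSum _ fun j _ => hΘi i j
  have hΘint : (∫ x, ∑ i, ∑ j, inner ℂ (φ j x) (φ i x) *
      inner ℂ (w i).1.snd (w j).1.snd ∂circleMeasure) = ∑ i, ((‖(w i).1.snd‖ : ℝ) : ℂ) ^ 2 := by
    rw [integral_finsetSum _ fun i _ => integrable_finsetSum _ fun j _ => hΘi i j]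
    refine Finset.sum_congr rfl fun i _ => ?_
    rw [integral_finsetSum _ fun j _ => hΘi i j, Finset.sum_eq_single i]
    · rw [integral_mul_const, ← L2.inner_def, inner_self_eq_norm_sq_to_K, hw.1 i,
        inner_self_eq_norm_sq_to_K]
      simp
    · intro j _ hji
      rw [integral_mul_const, ← L2.inner_def, hw.2 hji, zero_mul]
    · intro h
      exact absurd (Finset.mem_univ i) h
  have hPi : ∀ i, Integrable (potentialPairing V (φ i) (φ i)) circleMeasure := fun i =>
    potentialPairing_integrable hV (w i) (w i)
  have hP : Integrable (fun x => ∑ i, potentialPairing V (φ i) (φ i) x) circleMeasure :=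
    integrable_finsetSum _ fun i _ => hPi i
  have h3 : ∀ᵐ x ∂circleMeasure, x ∈ Ioo 0 (2 * Real.pi) := by
    rw [circleMeasure, ← restrict_Ioo_eq_restrict_Ioc]
    exact ae_restrict_mem measurableSet_Ioo
  have hrep : ∀ᵐ x ∂circleMeasure, ∀ i, φ i x = cauchySolution a (w i).1 x :=
    ae_all_iff.2 fun i => formEmbedding_ae (w i)
  have hle : (∫ x, (∑ i, potentialPairing V (φ i) (φ i) x).re ∂circleMeasure) ≤
      ∫ x, ((∑ i, ∑ j, inner ℂ (φ j x) (φ i x) * inner ℂ (w i).1.snd (w j).1.snd).re +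
        2 / (3 * Real.sqrt 3) * magneticConst (flux a) * tracePowThreeHalves (V x))
        ∂circleMeasure := by
    refine integral_mono_ae hP.re (hΘ.re.add (hV.integrable.const_mul _)) ?_
    filter_upwards [h3, hrep, hV.posSemidef] with x hx hx' hVx
    have := sum_potential_le hw hα hVx hx
    simp only [potentialPairing, hx']
    exact this
  have hΘre : Integrable (fun x => (∑ i, ∑ j, inner ℂ (φ j x) (φ i x) *
      inner ℂ (w i).1.snd (w j).1.snd).re) circleMeasure := hΘ.re
  rw [integral_add hΘre (hV.integrable.const_mul _), integral_const_mul] at hle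
  have e1 : (∫ x, (∑ i, ∑ j, inner ℂ (φ j x) (φ i x) *
      inner ℂ (w i).1.snd (w j).1.snd).re ∂circleMeasure) = ∑ i, ‖(w i).1.snd‖ ^ 2 := by
    have := integral_re hΘ
    simp only [RCLike.re_eq_complex_re] at this
    rw [this, hΘint]
    simp [← Complex.ofReal_pow]
  have e2 : (∫ x, (∑ i, potentialPairing V (φ i) (φ i) x).re ∂circleMeasure) =
      ∑ i, (∫ x, potentialPairing V (φ i) (φ i) x ∂circleMeasure).re := by
    have := integral_re hP
    simp only [RCLike.re_eq_complex_re] at this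
    rw [this, integral_finsetSum _ fun i _ => hPi i, Complex.re_sum]
  have e3 : ∀ i, (schrodingerForm ha hV (w i) (w i)).re = ‖(w i).1.snd‖ ^ 2 -
      (∫ x, potentialPairing V (φ i) (φ i) x ∂circleMeasure).re := by
    intro i
    rw [schrodingerForm_apply, Complex.sub_re, inner_self_eq_norm_sq_to_K]
    simp [← Complex.ofReal_pow, hφ]
  rw [e1, e2] at hle
  simp only [e3, Finset.sum_sub_distrib]
  linarith

/-! ### Negative eigenvalues -/

theorem mem_eigenspace_schrodingerOperator_iff (ha : IntegrableOn a (Ioc 0 (2 * Real.pi)))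
    (hV : IsAdmissible V) (z : ℂ) (u : L2Circle M) :
    u ∈ eigenspace (schrodingerOperator a V) z ↔ ∃ w : FormDomain M ha, formEmbedding M ha w = u ∧
      ∀ v, schrodingerForm ha hV v w = z * inner ℂ (formEmbedding M ha v) u := by
  have h := schrodingerOperator_iff ha hV u (z • u)
  simp only [inner_smul_right] at h
  exact h

theorem inner_eigenspace_eq_zero (ha : IntegrableOn a (Ioc 0 (2 * Real.pi)))
    (hV : IsAdmissible V) {l l' : ℝ} (hl : l ≠ l') {u u' : L2Circle M}
    (hu : u ∈ eigenspace (schrodingerOperator a V) (-(l : ℂ)))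
    (hu' : u' ∈ eigenspace (schrodingerOperator a V) (-(l' : ℂ))) : inner ℂ u u' = 0 := by
  obtain ⟨w, rfl, hw⟩ := (mem_eigenspace_schrodingerOperator_iff ha hV _ _).1 hu
  obtain ⟨w', rfl, hw'⟩ := (mem_eigenspace_schrodingerOperator_iff ha hV _ _).1 hu'
  have h1 := hw' w
  rw [schrodingerForm_conj, hw, map_mul, inner_conj_symm, map_neg, Complex.conj_ofReal] at h1
  have h2 : ((l : ℂ) - l') * inner ℂ (formEmbedding M ha w) (formEmbedding M ha w') = 0 := by
    linear_combination -h1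
  refine (mul_eq_zero.1 h2).resolve_left ?_
  exact sub_ne_zero.2 (Complex.ofReal_injective.ne hl)

theorem mem_spectrum_of_eigenspace_ne_bot {E : Type*} [NormedAddCommGroup E] [NormedSpace ℂ E]
    {T : E →ₗ.[ℂ] E} {z : ℂ} (h : eigenspace T z ≠ ⊥) : z ∈ spectrum T := by
  rintro ⟨R, hR⟩
  obtain ⟨u, ⟨hu, hu'⟩, hu0⟩ := (Submodule.ne_bot_iff _).1 h
  have h1 : R 0 = u := (hR 0 u).2 ⟨hu, sub_eq_zero.2 hu'⟩
  exact hu0 (by rw [← h1, map_zero])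

theorem negEigenvalueSum_le (ha : IntegrableOn a (Ioc 0 (2 * Real.pi))) (hV : IsAdmissible V)
    (hα : ∀ n : ℤ, flux a ≠ n) :
    negEigenvalueSum (schrodingerOperator a V) ≤
      ENNReal.ofReal (2 / (3 * Real.sqrt 3) * magneticConst (flux a) *
        ∫ x, tracePowThreeHalves (V x) ∂circleMeasure) := by
  classical
  set T := schrodingerOperator a V
  -- Needed for the orthonormal bases below, and so that `finrank` is the true multiplicity rather
  -- than its default value `0`.
  have hfin : ∀ l : negEigenvalues T, FiniteDimensional ℂ (eigenspace T (-((l : ℝ) : ℂ))) :=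
    fun l => ((hasDiscreteSpectrum_schrodingerOperator ha hV).2 _
      (mem_spectrum_of_eigenspace_ne_bot l.2.2)).2
  -- It suffices to bound finite partial sums: orthonormal bases of finitely many eigenspaces form
  -- one finite orthonormal family, to which `neg_sum_form_le` applies.
  rw [negEigenvalueSum, ENNReal.tsum_eq_iSup_sum]
  refine iSup_le fun S => ?_
  have hsum : ∑ l ∈ S, (Module.finrank ℂ (eigenspace T (-((l : ℝ) : ℂ))) : ENNReal) *
      ENNReal.ofReal l = ENNReal.ofReal
        (∑ l ∈ S, (Module.finrank ℂ (eigenspace T (-((l : ℝ) : ℂ))) : ℝ) * l) := by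
    rw [ENNReal.ofReal_sum_of_nonneg fun l _ => mul_nonneg (Nat.cast_nonneg _) l.2.1.le]
    refine Finset.sum_congr rfl fun l _ => ?_
    rw [ENNReal.ofReal_mul (Nat.cast_nonneg _), ENNReal.ofReal_natCast]
  rw [hsum]
  refine ENNReal.ofReal_le_ofReal ?_
  have horth : OrthogonalFamily ℂ (fun l : S => eigenspace T (-((l : ℝ) : ℂ)))
      fun l => (eigenspace T (-((l : ℝ) : ℂ))).subtypeₗᵢ := by
    intro l l' hll u u'
    refine inner_eigenspace_eq_zero ha hV ?_ u.2 u'.2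
    exact fun h => hll (Subtype.ext (Subtype.ext h))
  have hon := horth.orthonormal_sigma_orthonormal
    (v_family := fun l : S => stdOrthonormalBasis ℂ (eigenspace T (-((l : ℝ) : ℂ))))
    fun l => (stdOrthonormalBasis ℂ (eigenspace T (-((l : ℝ) : ℂ)))).orthonormal
  have hex : ∀ i : (l : S) × Fin (Module.finrank ℂ (eigenspace T (-((l : ℝ) : ℂ)))),
      ∃ w : FormDomain M ha, formEmbedding M ha w =
          (stdOrthonormalBasis ℂ (eigenspace T (-((i.1 : ℝ) : ℂ))) i.2 : L2Circle M) ∧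
        ∀ v, schrodingerForm ha hV v w = (-((i.1 : ℝ) : ℂ)) * inner ℂ (formEmbedding M ha v)
          (stdOrthonormalBasis ℂ (eigenspace T (-((i.1 : ℝ) : ℂ))) i.2 : L2Circle M) := fun i =>
    (mem_eigenspace_schrodingerOperator_iff ha hV _ _).1
      (stdOrthonormalBasis ℂ (eigenspace T (-((i.1 : ℝ) : ℂ))) i.2).2
  choose w hw1 hw2 using hex
  have hwon : Orthonormal ℂ fun i => formEmbedding M ha (w i) := by
    have : (fun i => formEmbedding M ha (w i)) = fun i =>
        (stdOrthonormalBasis ℂ (eigenspace T (-((i.1 : ℝ) : ℂ))) i.2 : L2Circle M) := funext hw1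
    rw [this]
    exact hon
  have hmain := neg_sum_form_le hwon hα hV
  refine le_trans (le_of_eq ?_) hmain
  have hre : ∀ i, (schrodingerForm ha hV (w i) (w i)).re = -(i.1 : ℝ) := by
    intro i
    rw [hw2 i (w i), ← hw1 i, inner_self_eq_norm_sq_to_K, hwon.1 i]
    simp
  simp only [hre, Finset.sum_neg_distrib, neg_neg]
  rw [Fintype.sum_sigma, ← Finset.sum_coe_sort]
  refine Finset.sum_congr rfl fun l _ => ?_
  simp

end

end MagneticLT

end

theorem theorem8 (M : ℕ) (a : ℝ → ℝ) (ha : IntegrableOn a (Ioc 0 (2 * Real.pi)))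
    (V : ℝ → Matrix (Fin M) (Fin M) ℂ)
    (hVmeas : AEStronglyMeasurable V (volume.restrict (Ioc 0 (2 * Real.pi))))
    (hVpos : ∀ᵐ x ∂(volume.restrict (Ioc 0 (2 * Real.pi))), (V x).PosSemidef)
    (hVint : IntegrableOn (fun x => MagneticLT.tracePowThreeHalves (V x))
      (Ioc 0 (2 * Real.pi))) :
    MagneticLT.HasDiscreteSpectrum (MagneticLT.schrodingerOperator a V) ∧
      ((∀ n : ℤ, MagneticLT.flux a ≠ n) →
        MagneticLT.negEigenvalueSum (MagneticLT.schrodingerOperator a V) ≤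
          ENNReal.ofReal (2 / (3 * Real.sqrt 3) * MagneticLT.magneticConst (MagneticLT.flux a) *
            ∫ x in (0 : ℝ)..(2 * Real.pi), MagneticLT.tracePowThreeHalves (V x))) := by
  have hV : MagneticLT.IsAdmissible V := ⟨hVmeas, hVpos, hVint⟩
  refine ⟨MagneticLT.hasDiscreteSpectrum_schrodingerOperator ha hV, fun hα => ?_⟩
  rw [intervalIntegral.integral_of_le MagneticLT.two_pi_nonneg]
  exact MagneticLT.negEigenvalueSum_le ha hV hα
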